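/- **Setting.** Let $n\ge 1$, $f:\mathbb R^n\to\mathbb R$, consider $\min f(x)$ subject to $x\ge 0$, and let $f\ge f_{\rm low}$ on $\{x>0\}$. $\|\cdot\|$ is the Euclidean norm (or the induced matrix norm), $X=\mathrm{diag}(x)$, $\bar X=\mathrm{diag}(\min(x_i,1))$, $\phi_\mu(x)=f(x)-\mu\sum_i\log x_i$, $e=(1,\dots,1)^\top$. The target conditions, with tolerances $\epsilon_g,\epsilon_H$, are (a) $x>0$, (b) $\nabla f(x)\ge-\epsilon_g e$, (c) $\|\bar X\nabla f(x)\|_\infty\le\epsilon_g$, (d) $\bar X\nabla^2 f(x)\bar X\succeq-\epsilon_H I$. **Algorithm (log-barrier Newton-CG).** Inputs: $\epsilon_g,\theta,\zeta_r,\bar\zeta,\eta\in(0,1)$, $\beta\in[\epsilon_g^{1/2},1)$, $\hat M\ge0$, $x^0>0$. Set $\epsilon_H=\epsilon_g^{1/2}$, $\mu=\epsilon_g/4$. Here $\mathrm{sgn}(t)\in\{-1,1\}$ is a sign of $t$ (either value if $t=0$). In iteration $k=0,1,2,\dots$ put $g=\bar X_k\nabla\phi_\mu(x^k)$, $H=\bar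 X_k\nabla^2\phi_\mu(x^k)\bar X_k$. * If $[\nabla f(x^k)]_i\le-\epsilon_g$ for some $i$ or $\|\bar X_k\nabla f(x^k)\|_\infty>\epsilon_g$, capped CG (below) with inputs $H$, $g$, $\epsilon=\epsilon_H$, $\zeta_r$, $c_\mu=\bar\zeta\mu$, $M=\hat M+\mu$ returns $\hat d$ and a type. For type NC, $d^k=-\mathrm{sgn}(g^\top\hat d)\min\{|\hat d^\top H\hat d|/\|\hat d\|^3,\ \beta/\|X_k^{-1}\bar X_k\hat d\|_\infty\}\,\hat d$; for type SOL, $d^k=\min\{1,\beta/\|X_k^{-1}\bar X_k\hat d\|_\infty\}\,\hat d$. * Otherwise the minimum eigenvalue oracle is called for $\bar X_k\nabla^2f(x^k)\bar X_k$. If it gives a certificate of (d), the algorithm terminates at $x^k$. If it returns a vector $v$, then $d^k=-\mathrm{sgn}(v^\top g)\min\{|v^\top Hv|,\ \beta/\|X_k^{-1}\bar X_kv\|_\infty\}\,v$. * Line search: $x^{k+1}=x^k+\theta^{j}\bar X_kd^k$ with the least integer $j\ge0$ such that $\phi_\mu(x^k+\theta^{j}\bar X_kd^k)<\phi_\mu(x^k)-\frac\eta6\theta^{3j}\|d^k\|^3$.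 *Capped CG.* Put $\bar H=H+2\epsilon I$ and, for the current value of $M$, $\kappa=(M+2\epsilon)/\epsilon$, $\hat\zeta_r=\zeta_r/(3\kappa)$, $\tau=\sqrt\kappa/(\sqrt\kappa+1)$, $T=4\kappa^4/(1-\sqrt\tau)^2$. Start with $y^0=0$, $r^0=g$, $p^0=-g$. If $(p^0)^\top\bar Hp^0<\epsilon\|p^0\|^2$, return $p^0$ (NC); otherwise replace $M$ by $\max\{M,\|Hp^0\|/\|p^0\|\}$. For $j=1,2,\dots$: obtain $y^j,r^j,p^j$ by a standard CG step ($\alpha=\|r\|^2/p^\top\bar Hp$, $y^+=y+\alpha p$, $r^+=r+\alpha\bar Hp$, $p^+=-r^++(\|r^+\|^2/\|r\|^2)p$), increase $M$ (if needed) to the least value with $\|Hv\|\le M\|v\|$ for all $v\in\{p^j,y^j,r^j\}$, and apply in this order: if $(y^j)^\top\bar Hy^j<\epsilon\|y^j\|^2$, return $y^j$ (NC); if $\|r^j\|\le\hat\zeta_r\|r^0\|$ and $\|r^j\|_\infty\le c_\mu$, return $y^j$ (SOL); if $(p^j)^\top\bar Hp^j<\epsilon\|p^j\|^2$, return $p^j$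 (NC); if $\|r^j\|>\sqrt T\tau^{j/2}\|r^0\|$, compute $y^{j+1}$ and return $d=y^{j+1}-y^i$ (NC) for some $i\in\{0,\dots,j-1\}$ with $d^\top\bar Hd<\epsilon\|d\|^2$. **Assumptions.** (1) There is an open set containing all iterates $x^k$ and all segments $[x^k,x^k+\bar X_kd^k]$ (on which the trial points lie) on which $f$ is twice continuously differentiable and $\nabla^2f$ is Lipschitz with constant $L_H>0$. (2) Each vector $v$ returned by the oracle satisfies $\|v\|=1$ and $v^\top\bar X_k\nabla^2f(x^k)\bar X_kv\le-\epsilon_H/2$. When the oracle is called at a point where (d) fails, the probability, conditional on the past of the algorithm, that it gives a (false) certificate is at most $\delta\in[0,1)$. **Constants.** Put $Q=(L_H+\eta)(1-\beta)^2+(2-\beta)$ and $$c_d=\min\Big\{\tfrac{1-\bar\zeta}9,\ \big(\tfrac3{2L_H}\big)^{1/2},\ \tfrac1{2(L_H+9/2+\zeta_r)}\Big\},\quad c_{\rm sol}=\min\Big\{c_d,\tfrac{6(1-\beta)^2\theta^2}{Q}\Big\},\quad c_{\rm nc}=\min\Big\{1,\tfrac{3(1-\beta)^2\theta}{Q}\Big\},$$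 $c_{\rm all}=\min\{c_{\rm sol},c_{\rm nc}\}$, $\omega_2=\max\{96\sqrt n/(\eta c_{\rm all}^2),\|x^0\|_\infty\}$ and $$\bar K_2=\left\lceil\frac{1536\big(f(x^0)-f_{\rm low}+\mu n(\log\omega_2-\min_i\log x^0_i)\big)}{\eta c_{\rm all}^3}\,\epsilon_g^{-3/2}\right\rceil+2 .$$ **Theorem.** Every run is well defined (each capped CG call and each line search finishes) and terminates within $\bar K_2$ iterations at a point satisfying (a)–(c). With probability at least $(1-\delta)^{\bar K_2}$ it terminates within $\bar K_2$ iterations at a point satisfying (a)–(d), and with probability at most $1-(1-\delta)^{\bar K_2}$ it terminates within $\bar K_2$ iterations at a point satisfying (a)–(c) but not (d). Moreover $\bar K_2=\tilde{\mathcal O}(n\epsilon_g^{-1/2}+\epsilon_g^{-3/2})$: for fixed $\theta,\zeta_r,\bar\zeta,\beta,\eta,L_H$, a fixed upper bound for $f(x^0)-f_{\rm low}\ge 0$, and fixed positive lower and upper bounds for the components of $x^0$, there is a constant $C$ such that $\bar K_2\le C(1+\log n)(n\epsilon_g^{-1/2}+\epsilon_g^{-3/2})$ for all $n\ge1$ and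 all admissible $\epsilon_g$ (those with $\epsilon_g\in(0,1)$ and $\epsilon_g^{1/2}\le\beta$). -/

import Mathlib

open scoped InnerProductSpace MeasureTheory

noncomputable section

namespace LBNCG

/-- Vectors in `ℝⁿ` with the Euclidean norm. -/
abbrev Vec (n : ℕ) : Type := EuclideanSpace ℝ (Fin n)

/-- The maximum norm of a vector. -/
def supNorm {n : ℕ} (v : Vec n) : ℝ := ‖(WithLp.ofLp v : Fin n → ℝ)‖

/-- The vector `x̄ = min(x, e)`. -/
def xbar {n : ℕ} (x : Vec n) : Vec n := WithLp.toLp 2 (fun i => min (x i) 1)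

/-- The diagonal matrix with diagonal `v`, acting on `ℝⁿ`. -/
def diagMap {n : ℕ} (v : Vec n) : Vec n →L[ℝ] Vec n :=
  Matrix.toEuclideanCLM (𝕜 := ℝ) (Matrix.diagonal (fun i => v i))

/-- The matrix `X̄`. -/
def Xbar {n : ℕ} (x : Vec n) : Vec n →L[ℝ] Vec n := diagMap (xbar x)

/-- The number `‖X⁻¹ X̄ d‖_∞`. -/
def relSize {n : ℕ} (x d : Vec n) : ℝ :=
  supNorm (WithLp.toLp 2 (fun i => (x i)⁻¹ * (Xbar x d) i) : Vec n)

/-- The Hessian, as the derivative of the gradient; its norm is the induced Euclidean norm. -/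
def hess {n : ℕ} (f : Vec n → ℝ) (x : Vec n) : Vec n →L[ℝ] Vec n :=
  fderiv ℝ (gradient f) x

/-- The log-barrier function `φ_μ(x) = f(x) - μ ∑ log x_i`. -/
def barrier {n : ℕ} (f : Vec n → ℝ) (μ : ℝ) (x : Vec n) : ℝ :=
  f x - μ * ∑ i, Real.log (x i)

/-- The scaled Hessian `X̄ ∇²h(x) X̄`. -/
def scaledHess {n : ℕ} (h : Vec n → ℝ) (x : Vec n) : Vec n →L[ℝ] Vec n :=
  (Xbar x).comp ((hess h x).comp (Xbar x))

/-- The scaled gradient `X̄ ∇h(x)`. -/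
def scaledGrad {n : ℕ} (h : Vec n → ℝ) (x : Vec n) : Vec n := Xbar x (gradient h x)

/-! ### Approximate optimality conditions -/

/-- `x > 0`, `∇f(x) ≥ -ε_g e`, `‖X̄ ∇f(x)‖_∞ ≤ ε_g`. -/
structure EpsFirstOrder {n : ℕ} (f : Vec n → ℝ) (εg : ℝ) (x : Vec n) : Prop where
  pos : ∀ i, 0 < x i
  grad : ∀ i, -εg ≤ gradient f x i
  compl : supNorm (scaledGrad f x) ≤ εg

/-- `X̄ ∇²f(x) X̄ ⪰ -ε_H I`. -/
def EpsSecondOrder {n : ℕ} (f : Vec n → ℝ) (εH : ℝ) (x : Vec n) : Prop :=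
  ∀ w : Vec n, -εH * ‖w‖ ^ 2 ≤ ⟪w, scaledHess f x w⟫_ℝ

/-- All the approximate optimality conditions. -/
def EpsKKT {n : ℕ} (f : Vec n → ℝ) (εg εH : ℝ) (x : Vec n) : Prop :=
  EpsFirstOrder f εg x ∧ EpsSecondOrder f εH x

/-! ### Capped conjugate gradient -/

/-- The variables of the capped CG loop. -/
structure CGState (n : ℕ) where
  y : Vec n
  r : Vec n
  p : Vec n
  M : ℝ

/-- The two types of output direction. -/
inductive DirType
  | NC
  | SOL

/-- `H̄ = H + 2 ε I`. -/
def damped {n : ℕ} (H : Vec n →L[ℝ] Vec n) (ε : ℝ) : Vec n →L[ℝ] Vec n :=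
  H + (2 * ε) • ContinuousLinearMap.id ℝ (Vec n)

/-- The estimate `M` is raised whenever `‖H v‖ > M ‖v‖`. -/
def raise {n : ℕ} (H : Vec n →L[ℝ] Vec n) (v : Vec n) (M : ℝ) : ℝ := max M (‖H v‖ / ‖v‖)

def cgInit {n : ℕ} (H : Vec n →L[ℝ] Vec n) (g : Vec n) (M : ℝ) : CGState n :=
  { y := 0, r := g, p := -g, M := raise H (-g) M }

/-- One pass of the standard CG operations, followed by the tests of `M` on `p`, `y` and `r`. -/
def cgStep {n : ℕ} (H : Vec n →L[ℝ] Vec n) (ε : ℝ) (s : CGState n) : CGState n :=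
  let α : ℝ := ⟪s.r, s.r⟫_ℝ / ⟪s.p, damped H ε s.p⟫_ℝ
  let y' := s.y + α • s.p
  let r' := s.r + α • damped H ε s.p
  let β : ℝ := ‖r'‖ ^ 2 / ‖s.r‖ ^ 2
  let p' := -r' + β • s.p
  { y := y', r := r', p := p', M := raise H r' (raise H y' (raise H p' s.M)) }

/-- The state with loop counter `j`. -/
def cgIter {n : ℕ} (H : Vec n →L[ℝ] Vec n) (g : Vec n) (ε M : ℝ) (j : ℕ) : CGState n :=
  (cgStep H ε)^[j] (cgInit H g M)

def kappa (ε M : ℝ) : ℝ := (M + 2 * ε) / ε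

def tau (ε M : ℝ) : ℝ := √(kappa ε M) / (√(kappa ε M) + 1)

def capT (ε M : ℝ) : ℝ := 4 * kappa ε M ^ 4 / (1 - √(tau ε M)) ^ 2

/-- `v` is a direction with `vᵀ H̄ v < ε ‖v‖²`. -/
def WeakCurv {n : ℕ} (H : Vec n →L[ℝ] Vec n) (ε : ℝ) (v : Vec n) : Prop :=
  ⟪v, damped H ε v⟫_ℝ < ε * ‖v‖ ^ 2

/-- Acceptance of the residual in a state. -/
def ResidualOK {n : ℕ} (g : Vec n) (ε ζr c : ℝ) (s : CGState n) : Prop :=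
  ‖s.r‖ ≤ ζr / (3 * kappa ε s.M) * ‖g‖ ∧ supNorm s.r ≤ c

/-- The residual in the state with loop counter `j` decreases too slowly. -/
def TooSlow {n : ℕ} (g : Vec n) (ε : ℝ) (j : ℕ) (s : CGState n) : Prop :=
  √(capT ε s.M) * tau ε s.M ^ ((j : ℝ) / 2) * ‖g‖ < ‖s.r‖

/-- One of the four termination tests succeeds for loop counter `j`. -/
def CGStops {n : ℕ} (H : Vec n →L[ℝ] Vec n) (g : Vec n) (ε ζr c M : ℝ) (j : ℕ) : Prop :=
  let s := cgIter H g ε M j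
  WeakCurv H ε s.y ∨ ResidualOK g ε ζr c s ∨ WeakCurv H ε s.p ∨ TooSlow g ε j s

/-- The output produced when the loop stops at counter `j`. -/
def CGReturns {n : ℕ} (H : Vec n →L[ℝ] Vec n) (g : Vec n) (ε ζr c M : ℝ) (j : ℕ)
    (t : DirType) (d : Vec n) : Prop :=
  let s := cgIter H g ε M j
  (WeakCurv H ε s.y ∧ t = .NC ∧ d = s.y) ∨
  (¬ WeakCurv H ε s.y ∧ ResidualOK g ε ζr c s ∧ t = .SOL ∧ d = s.y) ∨
  (¬ WeakCurv H ε s.y ∧ ¬ ResidualOK g ε ζr c s ∧ WeakCurv H ε s.p ∧ t = .NC ∧ d = s.p) ∨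
  (¬ WeakCurv H ε s.y ∧ ¬ ResidualOK g ε ζr c s ∧ ¬ WeakCurv H ε s.p ∧ TooSlow g ε j s ∧
    t = .NC ∧ ∃ i < j, d = (cgIter H g ε M (j + 1)).y - (cgIter H g ε M i).y ∧ WeakCurv H ε d)

/-- Capped CG with inputs `H`, `g`, `ε`, `ζ_r`, `c`, `M` can return the direction `d` of type `t`.
(The index `i` in the last way to stop is any admissible one.) -/
def CappedCG {n : ℕ} (H : Vec n →L[ℝ] Vec n) (g : Vec n) (ε ζr c M : ℝ)
    (t : DirType) (d : Vec n) : Prop :=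
  (WeakCurv H ε (-g) ∧ t = .NC ∧ d = -g) ∨
  (¬ WeakCurv H ε (-g) ∧ ∃ j, 1 ≤ j ∧
    (∀ l, 1 ≤ l → l < j → ¬ CGStops H g ε ζr c M l) ∧ CGReturns H g ε ζr c M j t d)

/-! ### The log-barrier Newton-CG algorithm -/

/-- The inputs of the algorithm other than the function and the starting point. -/
structure Params where
  εg : ℝ
  θ : ℝ
  ζr : ℝ
  ζbar : ℝ
  β : ℝ
  η : ℝ
  Mhat : ℝ

namespace Params

def εH (P : Params) : ℝ := √P.εg

def μ (P : Params) : ℝ := P.εg / 4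

def cμ (P : Params) : ℝ := P.ζbar * P.μ

def Mμ (P : Params) : ℝ := P.Mhat + P.μ

/-- The admissible inputs. -/
structure Valid (P : Params) : Prop where
  εg_pos : 0 < P.εg
  εg_lt : P.εg < 1
  θ_pos : 0 < P.θ
  θ_lt : P.θ < 1
  ζr_pos : 0 < P.ζr
  ζr_lt : P.ζr < 1
  ζbar_pos : 0 < P.ζbar
  ζbar_lt : P.ζbar < 1
  β_ge : √P.εg ≤ P.β
  β_lt : P.β < 1
  η_pos : 0 < P.η
  η_lt : P.η < 1
  Mhat_nonneg : 0 ≤ P.Mhat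

end Params

/-- An iteration is in progress, the algorithm has terminated, or an inner procedure
(capped CG or the line search) never delivers a result. -/
inductive Status
  | running
  | stopped
  | stuck

instance : MeasurableSpace Status := ⊤

/-- The state of the algorithm between two iterations. -/
abbrev State (n : ℕ) : Type := Status × Vec n

/-- The branch of the algorithm that calls the minimum eigenvalue oracle. -/
def CallsOracle {n : ℕ} (P : Params) (f : Vec n → ℝ) (x : Vec n) : Prop :=
  ¬ ((∃ i, gradient f x i ≤ -P.εg) ∨ P.εg < supNorm (scaledGrad f x))

/-- `σ` is a sign of `t`, a number in `{-1, 1}` also when `t = 0`. -/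
def IsSign (σ t : ℝ) : Prop := (σ = 1 ∨ σ = -1) ∧ σ * t = |t|

/-- The call of capped CG at `x` can return `d` of type `t`. -/
def CGCall {n : ℕ} (P : Params) (f : Vec n → ℝ) (x : Vec n) (t : DirType) (d : Vec n) : Prop :=
  CappedCG (scaledHess (barrier f P.μ) x) (scaledGrad (barrier f P.μ) x)
    P.εH P.ζr P.cμ P.Mμ t d

/-- `d` is the step scaled from a capped CG direction `v` of type `NC`. -/
def NCStep {n : ℕ} (P : Params) (f : Vec n → ℝ) (x v d : Vec n) : Prop :=
  ∃ σ, IsSign σ ⟪scaledGrad (barrier f P.μ) x, v⟫_ℝ ∧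
    d = (-σ * min (|⟪v, scaledHess (barrier f P.μ) x v⟫_ℝ| / ‖v‖ ^ 3) (P.β / relSize x v)) • v

/-- `d` is the step scaled from a capped CG direction `v` of type `SOL`. -/
def SOLStep {n : ℕ} (P : Params) (x v d : Vec n) : Prop :=
  d = min 1 (P.β / relSize x v) • v

/-- `d` is the step scaled from a direction `v` returned by the oracle. -/
def OracleStep {n : ℕ} (P : Params) (f : Vec n → ℝ) (x v d : Vec n) : Prop :=
  ∃ σ, IsSign σ ⟪v, scaledGrad (barrier f P.μ) x⟫_ℝ ∧
    d = (-σ * min |⟪v, scaledHess (barrier f P.μ) x v⟫_ℝ| (P.β / relSize x v)) • v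

/-- `d` is the search direction of an iteration that starts at `x`; `o` is the answer of the
oracle, `none` for a certificate and `some v` for a direction (not used when it is not called). -/
def SearchDir {n : ℕ} (P : Params) (f : Vec n → ℝ) (x : Vec n) (o : Option (Vec n))
    (d : Vec n) : Prop :=
  (¬ CallsOracle P f x ∧ ∃ v, (CGCall P f x .NC v ∧ NCStep P f x v d) ∨
    (CGCall P f x .SOL v ∧ SOLStep P x v d)) ∨
  (CallsOracle P f x ∧ ∃ v, o = some v ∧ OracleStep P f x v d)

/-- The decrease condition of the line search for the step length `θ ^ j`. -/
def Accepts {n : ℕ} (P : Params) (f : Vec n → ℝ) (x d : Vec n) (j : ℕ) : Prop :=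
  barrier f P.μ (x + P.θ ^ j • Xbar x d) <
    barrier f P.μ x - P.η / 6 * (P.θ ^ j) ^ 3 * ‖d‖ ^ 3

/-- The result of the backtracking line search. -/
def LineSearch {n : ℕ} (P : Params) (f : Vec n → ℝ) (x d : Vec n) (s' : State n) : Prop :=
  (∃ j, IsLeast {j | Accepts P f x d j} j ∧ s' = (.running, x + P.θ ^ j • Xbar x d)) ∨
  ((∀ j, ¬ Accepts P f x d j) ∧ s' = (.stuck, x))

/-- One iteration, from the state `s` to the state `s'`, with oracle answer `o` and search
direction `d`. A state that is not `running` does not change any more. -/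
def Iteration {n : ℕ} (P : Params) (f : Vec n → ℝ) (o : Option (Vec n)) (d : Vec n)
    (s s' : State n) : Prop :=
  (s.1 ≠ .running ∧ s' = s) ∨
  (s.1 = .running ∧ CallsOracle P f s.2 ∧ o = none ∧ s' = (.stopped, s.2)) ∨
  (s.1 = .running ∧ ¬ CallsOracle P f s.2 ∧ (¬ ∃ t v, CGCall P f s.2 t v) ∧
    s' = (.stuck, s.2)) ∨
  (s.1 = .running ∧ SearchDir P f s.2 o d ∧ LineSearch P f s.2 d s')

/-- `S`, `d`, `o` are the states, search directions and oracle answers of a run from `x0`;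
`S k` is the state after `k` iterations. -/
structure IsRun {n : ℕ} (P : Params) (f : Vec n → ℝ) (x0 : Vec n)
    (S : ℕ → State n) (d : ℕ → Vec n) (o : ℕ → Option (Vec n)) : Prop where
  init : S 0 = (.running, x0)
  step : ∀ k, Iteration P f (o k) (d k) (S k) (S (k + 1))

/-- `U` contains the path of the iterates and trial points of a run: all iterates `x` and all
segments from `x` to the first trial point `x + X̄ d`. -/
def ContainsPath {n : ℕ} (P : Params) (f : Vec n → ℝ) (U : Set (Vec n))
    (S : ℕ → State n) (d : ℕ → Vec n) (o : ℕ → Option (Vec n)) : Prop :=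
  ∀ k, (S k).2 ∈ U ∧ ((S k).1 = .running → SearchDir P f (S k).2 (o k) (d k) →
    segment ℝ (S k).2 ((S k).2 + Xbar (S k).2 (d k)) ⊆ U)

/-- `f` is twice continuously differentiable on the open set `U`, with a Hessian that is
Lipschitz continuous there with constant `LH`. -/
structure LipschitzHessianOn {n : ℕ} (f : Vec n → ℝ) (U : Set (Vec n)) (LH : ℝ) : Prop where
  isOpen : IsOpen U
  contDiffOn : ContDiffOn ℝ 2 f U
  lipschitz : ∀ x ∈ U, ∀ y ∈ U, ‖hess f x - hess f y‖ ≤ LH * ‖x - y‖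

/-- Every direction that the oracle returns in a run is a unit vector with curvature at most
`-ε_H / 2` for the scaled Hessian of `f`. -/
def OracleSound {n : ℕ} (P : Params) (f : Vec n → ℝ)
    (S : ℕ → State n) (o : ℕ → Option (Vec n)) : Prop :=
  ∀ k v, (S k).1 = .running → CallsOracle P f (S k).2 → o k = some v →
    ‖v‖ = 1 ∧ ⟪v, scaledHess f (S k).2 v⟫_ℝ ≤ -P.εH / 2

/-- Whatever happened before (the events of `ℱ k` are those that are settled when iteration `k`
begins), a call of the oracle at a point where `X̄ ∇²f(x) X̄ ⪰ -ε_H I` does not hold yields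
a (false) certificate with conditional probability at most `δ`. -/
def OracleFailureLe {n : ℕ} {Ω : Type*} [m : MeasurableSpace Ω] (ℙ : MeasureTheory.Measure Ω)
    (ℱ : MeasureTheory.Filtration ℕ m) (P : Params) (f : Vec n → ℝ)
    (S : ℕ → Ω → State n) (o : ℕ → Ω → Option (Vec n)) (δ : ℝ) : Prop :=
  ∀ k (A : Set Ω), MeasurableSet[ℱ k] A →
    (∀ ω ∈ A, (S k ω).1 = .running ∧ CallsOracle P f (S k ω).2 ∧
      ¬ EpsSecondOrder f P.εH (S k ω).2) →
    ℙ.real (A ∩ {ω | o k ω = none}) ≤ δ * ℙ.real A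

/-! ### The constants of the iteration bound -/

def cd (LH ζr ζbar : ℝ) : ℝ :=
  min ((1 - ζbar) / 9) (min (√(3 / (2 * LH))) (1 / (2 * (LH + 9 / 2 + ζr))))

def csol (LH θ ζr ζbar β η : ℝ) : ℝ :=
  min (cd LH ζr ζbar) (6 * (1 - β) ^ 2 * θ ^ 2 / ((LH + η) * (1 - β) ^ 2 + (2 - β)))

def cnc (LH θ β η : ℝ) : ℝ :=
  min 1 (3 * (1 - β) ^ 2 * θ / ((LH + η) * (1 - β) ^ 2 + (2 - β)))

def call (LH θ ζr ζbar β η : ℝ) : ℝ := min (csol LH θ ζr ζbar β η) (cnc LH θ β η)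

def omega2 {n : ℕ} (P : Params) (LH : ℝ) (x0 : Vec n) : ℝ :=
  max (96 * √(n : ℝ) / (P.η * call LH P.θ P.ζr P.ζbar P.β P.η ^ 2)) (supNorm x0)

/-- The iteration bound, as a function of the gap `Δ = f(x⁰) - f_low`. -/
def K2 {n : ℕ} (P : Params) (LH : ℝ) (x0 : Vec n) (Δ : ℝ) : ℕ :=
  ⌈1536 * (Δ + P.μ * n * (Real.log (omega2 P LH x0) - ⨅ i, Real.log (x0 i))) /
      (P.η * call LH P.θ P.ζr P.ζbar P.β P.η ^ 3) * P.εg ^ (-(3 / 2) : ℝ)⌉₊ + 2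

end LBNCG

end

namespace LBNCG

/-! ### Conjugate gradient iterations -/

section CG

variable {n : ℕ} {H : Vec n →L[ℝ] Vec n} {g : Vec n} {ε M : ℝ}

/-! The proof is an amortised descent argument for the log-barrier function. Put s₀ = c_all ε_H / 4.
Every move strictly decreases the barrier function, and a move of size s ≥ s₀ decreases it by more
than η s₀³ / 6 (`GoodMove`). Negative curvature directions, from capped CG or from the oracle,
always give such long moves (`move_of_negative_curvature`). A Newton direction can give a shorter
one only when it is accepted unscaled and without backtracking. Its small residual and Taylor's
formula then show that the new point passes both first-order tests (`callsOracle_of_short_newton`,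
`move_of_newton`). The next iteration therefore calls the oracle, and it either terminates or makes
a long move. Short moves are never consecutive, so about half of all moves are long; `Progress` is
the invariant that records this.

The barrier function need not be bounded below, since its logarithmic terms can tend to -∞ along
unbounded iterates. The tangent of the logarithm at ω₂ bounds this loss by a small multiple of the
distance from the start (`barrier_gap_le`). Conversely, a move of size s ≥ s₀ decreases the barrier
function by at least a multiple of s₀² s, so the distance is controlled by the decrease. The value
of ω₂ makes the loss at most half the decrease, up to a term from one short move. It can be
absorbed, and a run of K₂ unfinished iterations is contradictory (`not_progress_K2`).

Capped CG finishes because nonzero orthogonal residuals cannot continue forever in finite dimension.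
If its residual test detects slow decay, the required index i exists: otherwise the quadratic model
would be strongly convex along all segments from earlier iterates to y^{j+1}, and an
estimate-sequence argument gives a linear rate that excludes slow decay (`cgResidual_sq_le`,
`not_tooSlow`).

Termination and first-order optimality hold for every run. Only a false certificate can spoil the
second-order condition. Wrong termination and a new critical oracle call are disjoint events, so
their probabilities obey w_{k+1} ≤ w_k + δ(1 - w_k), hence w_k ≤ 1 - (1-δ)^k. -/

lemma damped_apply (H : Vec n →L[ℝ] Vec n) (ε : ℝ) (v : Vec n) :
    damped H ε v = H v + (2 * ε) • v := by
  simp [damped]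

lemma inner_damped (H : Vec n →L[ℝ] Vec n) (ε : ℝ) (v : Vec n) :
    ⟪v, damped H ε v⟫_ℝ = ⟪v, H v⟫_ℝ + 2 * ε * ‖v‖ ^ 2 := by
  rw [damped_apply, inner_add_right, inner_smul_right, real_inner_self_eq_norm_sq]

lemma damped_symm (hH : ∀ u v : Vec n, ⟪H u, v⟫_ℝ = ⟪u, H v⟫_ℝ) (u v : Vec n) :
    ⟪damped H ε u, v⟫_ℝ = ⟪u, damped H ε v⟫_ℝ := by
  simp only [damped_apply, inner_add_left, inner_add_right, inner_smul_left, inner_smul_right, hH]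
  simp

lemma cgIter_zero : cgIter H g ε M 0 = cgInit H g M := rfl

lemma cgIter_succ (j : ℕ) : cgIter H g ε M (j + 1) = cgStep H ε (cgIter H g ε M j) := by
  simp only [cgIter, Function.iterate_succ_apply']

/-- The CG step length. -/
noncomputable def cgAlpha (H : Vec n →L[ℝ] Vec n) (g : Vec n) (ε M : ℝ) (j : ℕ) : ℝ :=
  ‖(cgIter H g ε M j).r‖ ^ 2 / ⟪(cgIter H g ε M j).p, damped H ε (cgIter H g ε M j).p⟫_ℝ

lemma cgIter_y_succ (j : ℕ) : (cgIter H g ε M (j + 1)).y =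
    (cgIter H g ε M j).y + cgAlpha H g ε M j • (cgIter H g ε M j).p := by
  rw [cgIter_succ]; simp [cgStep, cgAlpha]

lemma cgIter_r_succ (j : ℕ) : (cgIter H g ε M (j + 1)).r =
    (cgIter H g ε M j).r + cgAlpha H g ε M j • damped H ε (cgIter H g ε M j).p := by
  rw [cgIter_succ]; simp [cgStep, cgAlpha]

lemma cgIter_p_succ (j : ℕ) : (cgIter H g ε M (j + 1)).p =
    -(cgIter H g ε M (j + 1)).r +
      (‖(cgIter H g ε M (j + 1)).r‖ ^ 2 / ‖(cgIter H g ε M j).r‖ ^ 2) • (cgIter H g ε M j).p := by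
  rw [cgIter_succ]; simp [cgStep]

lemma le_raise (v : Vec n) (M : ℝ) : M ≤ raise H v M := le_max_left _ _

lemma norm_le_raise (v : Vec n) (M : ℝ) : ‖H v‖ ≤ raise H v M * ‖v‖ := by
  rcases eq_or_ne v 0 with rfl | hv
  · simp
  · exact (div_le_iff₀ (norm_pos_iff.2 hv)).1 (le_max_right _ _)

lemma cgIter_M_le_succ (j : ℕ) : (cgIter H g ε M j).M ≤ (cgIter H g ε M (j + 1)).M := by
  rw [cgIter_succ]
  exact (le_raise _ _).trans ((le_raise _ _).trans (le_raise _ _))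

lemma cgIter_M_mono : Monotone fun j => (cgIter H g ε M j).M :=
  monotone_nat_of_le_succ cgIter_M_le_succ

lemma le_cgIter_M (j : ℕ) : M ≤ (cgIter H g ε M j).M :=
  (le_raise (H := H) (-g) M).trans (cgIter_M_mono (Nat.zero_le j))

lemma norm_apply_r_le {i j : ℕ} (hij : i ≤ j) :
    ‖H (cgIter H g ε M i).r‖ ≤ (cgIter H g ε M j).M * ‖(cgIter H g ε M i).r‖ := by
  refine le_trans ?_ (mul_le_mul_of_nonneg_right (cgIter_M_mono hij) (norm_nonneg _))
  cases i with
  | zero => simpa [cgIter_zero, cgInit] using norm_le_raise (H := H) (-g) M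
  | succ i =>
    show _ ≤ (cgIter H g ε M (i + 1)).M * _
    rw [cgIter_succ]
    exact norm_le_raise _ _

lemma cgIter_residual (j : ℕ) :
    (cgIter H g ε M j).r = damped H ε (cgIter H g ε M j).y + g := by
  induction j with
  | zero => simp [cgIter_zero, cgInit]
  | succ j ih => rw [cgIter_r_succ, cgIter_y_succ, map_add, map_smul, ih]; abel

/-- The orthogonality relations of CG, as long as there is no breakdown. -/
lemma cgIter_orthogonality (hH : ∀ u v : Vec n, ⟪H u, v⟫_ℝ = ⟪u, H v⟫_ℝ) {m : ℕ}
    (hr : ∀ l < m, (cgIter H g ε M l).r ≠ 0)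
    (hp : ∀ l < m, 0 < ⟪(cgIter H g ε M l).p, damped H ε (cgIter H g ε M l).p⟫_ℝ)
    {i : ℕ} (hi : i ≤ m) :
    (∀ l < i, ⟪(cgIter H g ε M i).r, (cgIter H g ε M l).p⟫_ℝ = 0 ∧
      ⟪(cgIter H g ε M i).r, (cgIter H g ε M l).r⟫_ℝ = 0 ∧
      ⟪(cgIter H g ε M i).p, damped H ε (cgIter H g ε M l).p⟫_ℝ = 0) ∧
    ⟪(cgIter H g ε M i).r, (cgIter H g ε M i).p⟫_ℝ = -‖(cgIter H g ε M i).r‖ ^ 2 := by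
  induction i with
  | zero => simp [cgIter_zero, cgInit]
  | succ i ih =>
    obtain ⟨ih1, ih2⟩ := ih (by omega)
    have hri := hr i (by omega)
    have hpi := hp i (by omega)
    have hrn : ‖(cgIter H g ε M i).r‖ ^ 2 ≠ 0 := pow_ne_zero 2 (norm_ne_zero_iff.2 hri)
    have hrp : ∀ l < i + 1, ⟪(cgIter H g ε M (i + 1)).r, (cgIter H g ε M l).p⟫_ℝ = 0 := by
      intro l hl
      rw [cgIter_r_succ, inner_add_left, inner_smul_left, damped_symm hH]
      rcases Nat.lt_succ_iff_lt_or_eq.1 hl with h | rfl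
      · rw [(ih1 l h).1, (ih1 l h).2.2]; simp
      · rw [ih2, cgAlpha]
        simp only [conj_trivial]
        field_simp
        ring
    -- Each residual is a combination of its own search direction and the preceding one, so
    -- orthogonality to directions implies orthogonality to residuals.
    have hrr : ∀ l < i + 1, ⟪(cgIter H g ε M (i + 1)).r, (cgIter H g ε M l).r⟫_ℝ = 0 := by
      intro l hl
      cases l with
      | zero =>
        have := hrp 0 hl
        simpa [cgIter_zero, cgInit] using this
      | succ l =>
        have h1 := hrp (l + 1) hl
        rw [cgIter_p_succ, inner_add_right, inner_smul_right, hrp l (by omega)] at h1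
        simpa using h1
    have hpA : ∀ l < i + 1,
        ⟪(cgIter H g ε M (i + 1)).p, damped H ε (cgIter H g ε M l).p⟫_ℝ = 0 := by
      intro l hl
      have hrl := hr l (by omega)
      have hpl := hp l (by omega)
      have hα : cgAlpha H g ε M l ≠ 0 :=
        div_ne_zero (pow_ne_zero 2 (norm_ne_zero_iff.2 hrl)) hpl.ne'
      -- Since the step length is nonzero, the image of a direction is a multiple of a residual
      -- difference; conjugacy thereby reduces to orthogonality of residuals.
      have hA : damped H ε (cgIter H g ε M l).p = (cgAlpha H g ε M l)⁻¹ •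
          ((cgIter H g ε M (l + 1)).r - (cgIter H g ε M l).r) := by
        rw [cgIter_r_succ, add_sub_cancel_left, smul_smul, inv_mul_cancel₀ hα, one_smul]
      rw [cgIter_p_succ, inner_add_left, inner_neg_left, inner_smul_left]
      rcases Nat.lt_succ_iff_lt_or_eq.1 hl with h | rfl
      · rw [(ih1 l h).2.2, hA, inner_smul_right, inner_sub_right, hrr l hl, hrr (l + 1) (by omega)]
        simp
      · rw [hA, inner_smul_right, inner_sub_right, hrr l hl, ← hA, real_inner_self_eq_norm_sq,
          cgAlpha]
        simp only [conj_trivial]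
        field_simp
        ring
    refine ⟨fun l hl => ⟨hrp l hl, hrr l hl, hpA l hl⟩, ?_⟩
    rw [cgIter_p_succ, inner_add_right, inner_smul_right, hrp i (by omega), inner_neg_right,
      real_inner_self_eq_norm_sq]
    simp

/-- The iterate y^l is a combination of the directions p^0, …, p^{l-1}, all orthogonal to r^i. -/
lemma inner_r_y_eq_zero (hH : ∀ u v : Vec n, ⟪H u, v⟫_ℝ = ⟪u, H v⟫_ℝ) {m : ℕ}
    (hr : ∀ l < m, (cgIter H g ε M l).r ≠ 0)
    (hp : ∀ l < m, 0 < ⟪(cgIter H g ε M l).p, damped H ε (cgIter H g ε M l).p⟫_ℝ)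
    {i l : ℕ} (hl : l ≤ i) (hi : i ≤ m) :
    ⟪(cgIter H g ε M i).r, (cgIter H g ε M l).y⟫_ℝ = 0 := by
  induction l with
  | zero => simp [cgIter_zero, cgInit]
  | succ l ih =>
    rw [cgIter_y_succ, inner_add_right, inner_smul_right, ih (by omega),
      ((cgIter_orthogonality hH hr hp hi).1 l (by omega)).1]
    simp

/-- The quadratic model of CG. -/
noncomputable def cgModel (H : Vec n →L[ℝ] Vec n) (g : Vec n) (ε : ℝ) (y : Vec n) : ℝ :=
  ⟪y, damped H ε y⟫_ℝ / 2 + ⟪g, y⟫_ℝ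

lemma cgModel_add (hH : ∀ u v : Vec n, ⟪H u, v⟫_ℝ = ⟪u, H v⟫_ℝ) (y z : Vec n) :
    cgModel H g ε (y + z) = cgModel H g ε y + ⟪damped H ε y + g, z⟫_ℝ +
      ⟪z, damped H ε z⟫_ℝ / 2 := by
  simp only [cgModel, map_add, inner_add_left, inner_add_right]
  rw [real_inner_comm (damped H ε y) z, damped_symm hH y z]
  ring

/-- The estimate M controls H only on vectors that were actually tested. By conjugacy, the curvature
of r^i is that of p^i plus a nonnegative multiple of that of p^{i-1}, so the bound at r^i carries
over to p^i. A later index j is allowed so that one estimate serves all earlier steps. -/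
lemma inner_p_damped_le (hH : ∀ u v : Vec n, ⟪H u, v⟫_ℝ = ⟪u, H v⟫_ℝ) {m : ℕ}
    (hr : ∀ l < m, (cgIter H g ε M l).r ≠ 0)
    (hp : ∀ l < m, 0 < ⟪(cgIter H g ε M l).p, damped H ε (cgIter H g ε M l).p⟫_ℝ)
    {i j : ℕ} (hi : i ≤ m) (hij : i ≤ j) :
    ⟪(cgIter H g ε M i).p, damped H ε (cgIter H g ε M i).p⟫_ℝ ≤
      ((cgIter H g ε M j).M + 2 * ε) * ‖(cgIter H g ε M i).r‖ ^ 2 := by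
  have h1 : ⟪(cgIter H g ε M i).r, damped H ε (cgIter H g ε M i).r⟫_ℝ ≤
      ((cgIter H g ε M j).M + 2 * ε) * ‖(cgIter H g ε M i).r‖ ^ 2 := by
    rw [inner_damped]
    have h2 := real_inner_le_norm (cgIter H g ε M i).r (H (cgIter H g ε M i).r)
    have h3 := mul_le_mul_of_nonneg_left (norm_apply_r_le (H := H) (g := g) (ε := ε) (M := M) hij)
      (norm_nonneg (cgIter H g ε M i).r)
    nlinarith
  refine le_trans ?_ h1
  cases i with
  | zero => simp [cgIter_zero, cgInit]
  | succ i =>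
    have h0 := ((cgIter_orthogonality hH hr hp hi).1 i (by omega)).2.2
    have h0' : ⟪(cgIter H g ε M i).p, damped H ε (cgIter H g ε M (i + 1)).p⟫_ℝ = 0 := by
      rw [← damped_symm hH, real_inner_comm]; exact h0
    have hpi := hp i (by omega)
    have e : (cgIter H g ε M (i + 1)).r = -(cgIter H g ε M (i + 1)).p +
      (‖(cgIter H g ε M (i + 1)).r‖ ^ 2 / ‖(cgIter H g ε M i).r‖ ^ 2) •
        (cgIter H g ε M i).p := by
      rw [cgIter_p_succ]; abel
    generalize ‖(cgIter H g ε M (i + 1)).r‖ ^ 2 / ‖(cgIter H g ε M i).r‖ ^ 2 = b at e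
    rw [e]
    simp only [map_add, map_neg, map_smul, inner_add_left, inner_add_right, inner_neg_left,
      inner_neg_right, inner_smul_left, inner_smul_right, conj_trivial, h0, h0']
    nlinarith [mul_nonneg (sq_nonneg b) hpi.le]

/-- The CG step minimises the model along p^i, and the exact gain is ‖r‖⁴ / (2 pᵀH̄p). -/
lemma cgModel_succ_le (hH : ∀ u v : Vec n, ⟪H u, v⟫_ℝ = ⟪u, H v⟫_ℝ) {m : ℕ}
    (hr : ∀ l < m, (cgIter H g ε M l).r ≠ 0)
    (hp : ∀ l < m, 0 < ⟪(cgIter H g ε M l).p, damped H ε (cgIter H g ε M l).p⟫_ℝ)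
    {i j : ℕ} (hi : i < m) (hij : i ≤ j) :
    cgModel H g ε (cgIter H g ε M (i + 1)).y + ‖(cgIter H g ε M i).r‖ ^ 2 /
      (2 * ((cgIter H g ε M j).M + 2 * ε)) ≤ cgModel H g ε (cgIter H g ε M i).y := by
  have h1 := inner_p_damped_le hH hr hp hi.le hij
  have h2 := (cgIter_orthogonality hH hr hp hi.le).2
  have hpi := hp i hi
  have hrn : 0 < ‖(cgIter H g ε M i).r‖ ^ 2 := by
    have := norm_pos_iff.2 (hr i hi); positivity
  rw [cgIter_y_succ, cgModel_add hH, ← cgIter_residual, inner_smul_right, h2, map_smul,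
    inner_smul_left, inner_smul_right, cgAlpha]
  simp only [conj_trivial]
  set q := ⟪(cgIter H g ε M i).p, damped H ε (cgIter H g ε M i).p⟫_ℝ
  set ρ := ‖(cgIter H g ε M i).r‖ ^ 2
  set L := (cgIter H g ε M j).M + 2 * ε
  have hL : 0 < L := by
    by_contra h
    nlinarith
  have h3 : ρ / (2 * L) ≤ ρ ^ 2 / (2 * q) := by
    rw [div_le_div_iff₀ (by positivity) (by positivity)]
    nlinarith
  have h4 : ρ / q * -ρ + ρ / q * (ρ / q * q) / 2 = - (ρ ^ 2 / (2 * q)) := by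
    field_simp; ring
  linarith

end CG

/-! ### Linear rate and termination of capped CG -/

section CappedCG

variable {n : ℕ} {H : Vec n →L[ℝ] Vec n} {g : Vec n} {ε M : ℝ}

/-- The companion sequence of CG in the estimate-sequence argument for its linear rate. -/
noncomputable def cgCompanion (H : Vec n →L[ℝ] Vec n) (g : Vec n) (ε M a : ℝ) : ℕ → Vec n
  | 0 => 0
  | i + 1 => (1 - a) • cgCompanion H g ε M a i +
      a • ((cgIter H g ε M i).y - ε⁻¹ • (cgIter H g ε M i).r)

/-- The companion sequence lies in the span of earlier iterates and residuals. This orthogonality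
removes the cross terms that an accelerated gradient method removes by its extrapolation. -/
lemma inner_r_companion_eq_zero (hH : ∀ u v : Vec n, ⟪H u, v⟫_ℝ = ⟪u, H v⟫_ℝ) {m : ℕ}
    (hr : ∀ l < m, (cgIter H g ε M l).r ≠ 0)
    (hp : ∀ l < m, 0 < ⟪(cgIter H g ε M l).p, damped H ε (cgIter H g ε M l).p⟫_ℝ)
    (a : ℝ) {i l : ℕ} (hl : l ≤ i) (hi : i ≤ m) :
    ⟪(cgIter H g ε M i).r, cgCompanion H g ε M a l⟫_ℝ = 0 := by
  induction l with
  | zero => simp [cgCompanion]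
  | succ l ih =>
    rw [cgCompanion, inner_add_right, inner_smul_right, inner_smul_right, ih (by omega),
      inner_sub_right, inner_smul_right, inner_r_y_eq_zero hH hr hp (by omega) hi,
      ((cgIter_orthogonality hH hr hp hi).1 l (by omega)).2.1]
    simp

lemma norm_convexComb_sq_le {a : ℝ} (h0 : 0 ≤ a) (h1 : a ≤ 1) (u w : Vec n) :
    ‖(1 - a) • u + a • w‖ ^ 2 ≤ (1 - a) * ‖u‖ ^ 2 + a * ‖w‖ ^ 2 := by
  have e : (1 - a) * ‖u‖ ^ 2 + a * ‖w‖ ^ 2 - ‖(1 - a) • u + a • w‖ ^ 2 =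
      a * (1 - a) * ‖u - w‖ ^ 2 := by
    rw [norm_add_sq_real, norm_sub_sq_real, norm_smul, norm_smul, inner_smul_left,
      inner_smul_right, mul_pow, mul_pow, Real.norm_eq_abs, Real.norm_eq_abs, sq_abs, sq_abs]
    simp only [conj_trivial]
    ring
  have : 0 ≤ a * (1 - a) * ‖u - w‖ ^ 2 := by
    have : 0 ≤ 1 - a := by linarith
    positivity
  linarith

/-- The linear rate of CG: if no direction from an earlier iterate to `y^{j+1}` has weak
curvature, then the residual decreases at least at the rate `τ`. -/
lemma cgResidual_sq_le (hH : ∀ u v : Vec n, ⟪H u, v⟫_ℝ = ⟪u, H v⟫_ℝ) (hε : 0 < ε) (hM : 0 ≤ M)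
    {j : ℕ} (hj : 1 ≤ j)
    (hr : ∀ l < j + 1, (cgIter H g ε M l).r ≠ 0)
    (hp : ∀ l < j + 1, 0 < ⟪(cgIter H g ε M l).p, damped H ε (cgIter H g ε M l).p⟫_ℝ)
    (hw : ∀ i < j, ¬ WeakCurv H ε ((cgIter H g ε M (j + 1)).y - (cgIter H g ε M i).y)) :
    ‖(cgIter H g ε M j).r‖ ^ 2 ≤
      2 * kappa ε (cgIter H g ε M j).M * tau ε (cgIter H g ε M j).M ^ j * ‖g‖ ^ 2 := by
  have hMj : 0 ≤ (cgIter H g ε M j).M := hM.trans (le_cgIter_M j)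
  set Mj := (cgIter H g ε M j).M with hMjdef
  set L := Mj + 2 * ε with hLdef
  have hL : 0 < L := by positivity
  set κ := kappa ε Mj with hκdef
  have hκ : κ = L / ε := rfl
  have hκ1 : 1 < κ := by rw [hκ, lt_div_iff₀ hε]; linarith
  have hs1 : 1 < √κ := by rw [Real.lt_sqrt (by norm_num)]; simpa using hκ1
  -- With a² = ε/L the squared residual produced by the companion update equals the gain of the
  -- model in a CG step, so the two cancel.
  set a := 1 / √κ with hadef
  have ha0 : 0 < a := by positivity
  have ha1 : a < 1 := by rw [hadef, div_lt_one (by linarith)]; exact hs1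
  have ha2 : a ^ 2 = ε / L := by
    rw [hadef, div_pow, Real.sq_sqrt (by linarith), hκ]; simp
  -- This is (√κ - 1)(√κ + 1) ≤ κ.
  have hτ : 1 - a ≤ tau ε Mj := by
    rw [tau, ← hκdef, hadef, le_div_iff₀ (by linarith)]
    have : √κ ≠ 0 := by linarith
    field_simp
    nlinarith
  set z := (cgIter H g ε M (j + 1)).y with hz
  set Φ := cgModel H g ε
  have hry : ∀ i ≤ j + 1, ⟪(cgIter H g ε M i).r, (cgIter H g ε M i).y⟫_ℝ = 0 :=
    fun i hi => inner_r_y_eq_zero hH hr hp le_rfl hi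
  -- Absence of weak curvature along z - y^i is strong convexity of the model on that line. The last
  -- iterate z replaces the minimiser, which need not exist.
  have hstrong : ∀ i < j, Φ (cgIter H g ε M i).y - Φ z + ε / 2 * ‖(cgIter H g ε M i).y - z‖ ^ 2 ≤
      -⟪(cgIter H g ε M i).r, z⟫_ℝ := by
    intro i hi
    have h1 := cgModel_add (H := H) (g := g) (ε := ε) hH (cgIter H g ε M i).y
      (z - (cgIter H g ε M i).y)
    rw [add_sub_cancel, ← cgIter_residual, inner_sub_right, hry i (by omega)] at h1
    have h2 := not_lt.1 (hw i hi)
    rw [norm_sub_rev]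
    linarith
  -- The potential of the estimate sequence contracts by the factor 1 - a in each step.
  have hE : ∀ i ≤ j, Φ (cgIter H g ε M i).y - Φ z + ε / 2 * ‖cgCompanion H g ε M a i - z‖ ^ 2 ≤
      (1 - a) ^ i * (‖g‖ ^ 2 / ε) := by
    intro i
    induction i with
    | zero =>
      intro _
      have h1 := hstrong 0 (by omega)
      have h2 := cgModel_add (H := H) (g := g) (ε := ε) hH z (0 - z)
      rw [add_sub_cancel, ← cgIter_residual, inner_sub_right, hry (j + 1) le_rfl] at h2
      have h3 := not_lt.1 (hw 0 (by omega))
      have h4 := real_inner_le_norm (-g) z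
      simp only [cgIter_zero, cgInit, cgCompanion, zero_sub, norm_neg, inner_neg_left, map_neg,
        inner_neg_right, neg_neg, inner_zero_right, sub_zero] at h1 h2 h3 h4 ⊢
      -- Add the strong convexity inequalities based at 0 and at z; the residual at z is orthogonal
      -- to z.
      have hzg : ε * ‖z‖ ≤ ‖g‖ := by
        rcases (norm_nonneg z).eq_or_lt with h | h
        · rw [← h]; simp
        · refine le_of_mul_le_mul_right ?_ h
          change Φ 0 = Φ z + 0 + _ at h2
          nlinarith
      have h5 : ‖g‖ * ‖z‖ ≤ ‖g‖ ^ 2 / ε := by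
        rw [le_div_iff₀ hε]
        nlinarith [norm_nonneg g]
      simp only [pow_zero, one_mul]
      linarith
    | succ i ih =>
      intro hi
      have ih := ih (by omega)
      have h1 := hstrong i (by omega)
      have h2 := cgModel_succ_le hH hr hp (i := i) (j := j) (by omega) (by omega)
      have hrv := inner_r_companion_eq_zero hH hr hp a (i := i) (l := i) le_rfl (by omega)
      have h3 := norm_convexComb_sq_le ha0.le ha1.le (cgCompanion H g ε M a i - z)
        ((cgIter H g ε M i).y - z)
      have e : cgCompanion H g ε M a (i + 1) - z =
          ((1 - a) • (cgCompanion H g ε M a i - z) + a • ((cgIter H g ε M i).y - z)) -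
            (a / ε) • (cgIter H g ε M i).r := by
        rw [cgCompanion]
        module
      have h4 : ‖cgCompanion H g ε M a (i + 1) - z‖ ^ 2 =
          ‖(1 - a) • (cgCompanion H g ε M a i - z) + a • ((cgIter H g ε M i).y - z)‖ ^ 2
          + 2 * (a / ε) * ⟪(cgIter H g ε M i).r, z⟫_ℝ +
          a ^ 2 / ε ^ 2 * ‖(cgIter H g ε M i).r‖ ^ 2 := by
        rw [e, norm_sub_sq_real, norm_smul, mul_pow, Real.norm_eq_abs, sq_abs, inner_smul_right,
          real_inner_comm, inner_add_right, inner_smul_right, inner_smul_right, inner_sub_right,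
          inner_sub_right, hrv, hry i (by omega)]
        ring
      set E := Φ (cgIter H g ε M i).y - Φ z
      set R := ‖(cgIter H g ε M i).r‖ ^ 2
      have h5 : ε / 2 * ‖cgCompanion H g ε M a (i + 1) - z‖ ^ 2 ≤
          (1 - a) * (ε / 2 * ‖cgCompanion H g ε M a i - z‖ ^ 2) - a * E + R / (2 * L) := by
        have h6 : ε / 2 * (2 * (a / ε) * ⟪(cgIter H g ε M i).r, z⟫_ℝ) ≤
            -(a * E) - a * (ε / 2 * ‖(cgIter H g ε M i).y - z‖ ^ 2) := by
          have : ε / 2 * (2 * (a / ε) * ⟪(cgIter H g ε M i).r, z⟫_ℝ) =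
            a * ⟪(cgIter H g ε M i).r, z⟫_ℝ := by field_simp
          rw [this]
          nlinarith
        have h7 : ε / 2 * (a ^ 2 / ε ^ 2 * R) = R / (2 * L) := by
          rw [ha2]; field_simp
        have h8 := mul_le_mul_of_nonneg_left h3 (by positivity : 0 ≤ ε / 2)
        rw [h4]
        linarith
      rw [pow_succ (1 - a)]
      have h9 := mul_le_mul_of_nonneg_left ih (by linarith : 0 ≤ 1 - a)
      change Φ (cgIter H g ε M (i + 1)).y + R / (2 * L) ≤ _ at h2
      have h10 : Φ (cgIter H g ε M (i + 1)).y - Φ z ≤ E - R / (2 * L) := by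
        change _ ≤ Φ (cgIter H g ε M i).y - Φ z - _
        change _ ≤ Φ _ at h2
        linarith
      linarith
  have h1 := hE j le_rfl
  -- The last CG step leads from y^j to z, so the model gap at y^j already bounds the residual.
  have h2 := cgModel_succ_le hH hr hp (i := j) (j := j) (by omega) le_rfl
  change Φ z + ‖(cgIter H g ε M j).r‖ ^ 2 / (2 * L) ≤ Φ _ at h2
  have h3 : (1 - a) ^ j ≤ tau ε Mj ^ j := pow_le_pow_left₀ (by linarith) hτ j
  have h4 : ‖(cgIter H g ε M j).r‖ ^ 2 / (2 * L) ≤ tau ε Mj ^ j * (‖g‖ ^ 2 / ε) := by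
    have h5 : 0 ≤ ε / 2 * ‖cgCompanion H g ε M a j - z‖ ^ 2 := by positivity
    have h6 := mul_le_mul_of_nonneg_right h3 (by positivity : 0 ≤ ‖g‖ ^ 2 / ε)
    linarith
  rw [div_le_iff₀ (by positivity)] at h4
  calc ‖(cgIter H g ε M j).r‖ ^ 2 ≤ _ := h4
    _ = 2 * κ * tau ε Mj ^ j * ‖g‖ ^ 2 := by rw [hκ]; field_simp

lemma two_le_kappa (hε : 0 < ε) (hM : 0 ≤ M) : 2 ≤ kappa ε M := by
  rw [kappa, le_div_iff₀ hε]; linarith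

/-- The proved rate has the factor 2κ, and T is at least 2κ because κ ≥ 1 and 0 < √τ < 1. -/
lemma not_tooSlow (hH : ∀ u v : Vec n, ⟪H u, v⟫_ℝ = ⟪u, H v⟫_ℝ) (hε : 0 < ε) (hM : 0 ≤ M)
    {j : ℕ} (hj : 1 ≤ j)
    (hr : ∀ l < j + 1, (cgIter H g ε M l).r ≠ 0)
    (hp : ∀ l < j + 1, 0 < ⟪(cgIter H g ε M l).p, damped H ε (cgIter H g ε M l).p⟫_ℝ)
    (hw : ∀ i < j, ¬ WeakCurv H ε ((cgIter H g ε M (j + 1)).y - (cgIter H g ε M i).y)) :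
    ¬ TooSlow g ε j (cgIter H g ε M j) := by
  have h := cgResidual_sq_le hH hε hM hj hr hp hw
  have hκ := two_le_kappa hε (hM.trans (le_cgIter_M (H := H) (g := g) (ε := ε) (M := M) j))
  rw [TooSlow, not_lt]
  set κ := kappa ε (cgIter H g ε M j).M with hκdef
  set t := tau ε (cgIter H g ε M j).M with htdef
  have hs : 0 < √κ := Real.sqrt_pos.2 (by linarith)
  have ht0 : 0 < t := by rw [htdef, tau, ← hκdef]; positivity
  have ht1 : t < 1 := by
    rw [htdef, tau, ← hκdef, div_lt_one (by positivity)]; linarith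
  have hst0 : 0 < √t := Real.sqrt_pos.2 ht0
  have hst1 : √t < 1 := by rw [Real.sqrt_lt' one_pos]; simpa using ht1
  have hT : 2 * κ ≤ capT ε (cgIter H g ε M j).M := by
    rw [capT, ← hκdef, ← htdef, le_div_iff₀ (by nlinarith)]
    have h1 : (1 - √t) ^ 2 ≤ 1 := by nlinarith
    have h2 : 2 * κ * (1 - √t) ^ 2 ≤ 2 * κ := by nlinarith
    have h3 : κ ≤ κ ^ 4 := le_self_pow₀ (by linarith) (by norm_num)
    linarith
  have e : t ^ ((j : ℝ) / 2) = √(t ^ j) := by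
    rw [Real.sqrt_eq_rpow, ← Real.rpow_natCast, ← Real.rpow_mul ht0.le]
    congr 1; ring
  have hpow : 0 ≤ t ^ j := by positivity
  refine abs_le_of_sq_le_sq' ?_ (by positivity) |>.2
  rw [e, mul_pow, mul_pow, Real.sq_sqrt (by linarith), Real.sq_sqrt hpow]
  refine h.trans ?_
  gcongr

lemma inner_p_damped_pos (hε : 0 < ε) {v : Vec n} (hv : v ≠ 0) (h : ¬ WeakCurv H ε v) :
    0 < ⟪v, damped H ε v⟫_ℝ := by
  have h1 := norm_pos_iff.2 hv
  exact lt_of_lt_of_le (by positivity) (not_lt.1 h)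

variable {ζr c : ℝ}

lemma residualOK_of_eq_zero (hε : 0 < ε) (hM : 0 ≤ M) (hζ : 0 < ζr) (hc : 0 < c) {s : CGState n}
    (hs : M ≤ s.M) (h : s.r = 0) : ResidualOK g ε ζr c s := by
  have hκ := two_le_kappa hε (hM.trans hs)
  have : 0 < kappa ε s.M := by linarith
  refine ⟨by rw [h, norm_zero]; positivity, ?_⟩
  rw [h]; simpa [supNorm] using hc.le

/-- As long as no test of capped CG succeeds, there is no breakdown. -/
lemma cg_no_breakdown (hH : ∀ u v : Vec n, ⟪H u, v⟫_ℝ = ⟪u, H v⟫_ℝ) (hε : 0 < ε) (hM : 0 ≤ M)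
    (hζ : 0 < ζr) (hc : 0 < c) (h0 : ¬ WeakCurv H ε (-g)) (hg : g ≠ 0) {m : ℕ}
    (htests : ∀ l, 1 ≤ l → l < m → ¬ ResidualOK g ε ζr c (cgIter H g ε M l) ∧
      ¬ WeakCurv H ε (cgIter H g ε M l).p) :
    (∀ l < m, (cgIter H g ε M l).r ≠ 0) ∧
    (∀ l < m, 0 < ⟪(cgIter H g ε M l).p, damped H ε (cgIter H g ε M l).p⟫_ℝ) := by
  have hr : ∀ l < m, (cgIter H g ε M l).r ≠ 0 := by
    intro l hl
    cases l with
    | zero => simpa [cgIter_zero, cgInit] using hg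
    | succ l =>
      exact fun h => (htests (l + 1) (by omega) hl).1
        (residualOK_of_eq_zero hε hM hζ hc (le_cgIter_M _) h)
  refine ⟨hr, fun l => ?_⟩
  induction l using Nat.strong_induction_on with
  | _ l ih =>
    intro hl
    have h1 := (cgIter_orthogonality hH (m := l) (fun i hi => hr i (by omega))
      (fun i hi => ih i hi (by omega)) le_rfl).2
    -- A vanishing direction would contradict rᵀp = -‖r‖², as r is nonzero.
    have hpl : (cgIter H g ε M l).p ≠ 0 := by
      intro h
      rw [h, inner_zero_right] at h1
      have := norm_pos_iff.2 (hr l hl)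
      nlinarith
    refine inner_p_damped_pos hε hpl ?_
    cases l with
    | zero => simpa [cgIter_zero, cgInit] using h0
    | succ l => exact (htests (l + 1) (by omega) hl).2

/-- Capped CG finishes. -/
theorem cappedCG_exists (hH : ∀ u v : Vec n, ⟪H u, v⟫_ℝ = ⟪u, H v⟫_ℝ) (hε : 0 < ε) (hM : 0 ≤ M)
    (hζ : 0 < ζr) (hc : 0 < c) (hg : g ≠ 0) :
    ∃ t d, CappedCG H g ε ζr c M t d := by
  classical
  by_cases h0 : WeakCurv H ε (-g)
  · exact ⟨_, _, Or.inl ⟨h0, rfl, rfl⟩⟩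
  have hex : ∃ j, 1 ≤ j ∧ CGStops H g ε ζr c M j := by
    by_contra! hno
    have hnb := fun m => cg_no_breakdown (m := m) hH hε hM hζ hc h0 hg (fun l hl _ =>
      ⟨fun h => hno l hl (Or.inr (Or.inl h)), fun h => hno l hl (Or.inr (Or.inr (Or.inl h)))⟩)
    -- If no test ever succeeded, there would be an infinite orthogonal family of nonzero residuals
    -- in ℝⁿ.
    have hli : LinearIndependent ℝ (fun j => (cgIter H g ε M j).r) := by
      refine linearIndependent_of_ne_zero_of_inner_eq_zero
        (fun j => (hnb (j + 1)).1 j (by omega)) ?_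
      intro i j hij
      rcases Nat.lt_or_gt_of_ne hij with h | h
      · change ⟪(cgIter H g ε M i).r, (cgIter H g ε M j).r⟫_ℝ = 0
        rw [real_inner_comm]
        exact ((cgIter_orthogonality hH (hnb j).1 (hnb j).2 le_rfl).1 i h).2.1
      · exact ((cgIter_orthogonality hH (hnb i).1 (hnb i).2 le_rfl).1 j h).2.1
    exact Set.infinite_univ (α := ℕ) (Set.finite_univ_iff.2 hli.finite)
  obtain ⟨hj1, hj⟩ := Nat.find_spec hex
  set j := Nat.find hex
  have hmin : ∀ l, 1 ≤ l → l < j → ¬ CGStops H g ε ζr c M l :=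
    fun l hl hlj h => Nat.find_min hex hlj ⟨hl, h⟩
  suffices h : ∃ t d, CGReturns H g ε ζr c M j t d by
    obtain ⟨t, d, h⟩ := h
    exact ⟨t, d, Or.inr ⟨h0, j, hj1, hmin, h⟩⟩
  by_cases hy : WeakCurv H ε (cgIter H g ε M j).y
  · exact ⟨_, _, Or.inl ⟨hy, rfl, rfl⟩⟩
  by_cases hres : ResidualOK g ε ζr c (cgIter H g ε M j)
  · exact ⟨_, _, Or.inr (Or.inl ⟨hy, hres, rfl, rfl⟩)⟩
  by_cases hp : WeakCurv H ε (cgIter H g ε M j).p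
  · exact ⟨_, _, Or.inr (Or.inr (Or.inl ⟨hy, hres, hp, rfl, rfl⟩))⟩
  have hslow : TooSlow g ε j (cgIter H g ε M j) :=
    ((hj.resolve_left hy).resolve_left hres).resolve_left hp
  have hnb := cg_no_breakdown (m := j + 1) hH hε hM hζ hc h0 hg (M := M) (fun l hl hlj => by
    rcases Nat.lt_succ_iff_lt_or_eq.1 hlj with h | rfl
    · exact ⟨fun h' => hmin l hl h (Or.inr (Or.inl h')),
        fun h' => hmin l hl h (Or.inr (Or.inr (Or.inl h')))⟩
    · exact ⟨hres, hp⟩)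
  have hi : ∃ i < j, WeakCurv H ε ((cgIter H g ε M (j + 1)).y - (cgIter H g ε M i).y) := by
    by_contra! hw
    exact not_tooSlow hH hε hM hj1 hnb.1 hnb.2 hw hslow
  obtain ⟨i, hij, hi⟩ := hi
  exact ⟨_, _, Or.inr (Or.inr (Or.inr ⟨hy, hres, hp, hslow, rfl, i, hij, rfl, hi⟩))⟩

theorem cappedCG_nc {d : Vec n} (h : CappedCG H g ε ζr c M .NC d) : WeakCurv H ε d := by
  rcases h with ⟨h, -, rfl⟩ | ⟨-, j, -, -, h⟩
  · exact h
  · rcases h with ⟨h, -, rfl⟩ | ⟨-, -, h, -⟩ | ⟨-, -, h, -, rfl⟩ | ⟨-, -, -, -, -, i, -, -, h⟩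
    · exact h
    · cases h
    · exact h
    · exact h

/-- The equality expresses that the residual H̄d + g is orthogonal to the iterate d. -/
theorem cappedCG_sol (hH : ∀ u v : Vec n, ⟪H u, v⟫_ℝ = ⟪u, H v⟫_ℝ) (hε : 0 < ε) (hM : 0 ≤ M)
    (hζ : 0 < ζr) (hc : 0 < c) (hg : g ≠ 0) {d : Vec n} (h : CappedCG H g ε ζr c M .SOL d) :
    ε * ‖d‖ ^ 2 ≤ ⟪d, damped H ε d⟫_ℝ ∧ ⟪g, d⟫_ℝ = -⟪d, damped H ε d⟫_ℝ ∧
      supNorm (damped H ε d + g) ≤ c := by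
  rcases h with ⟨-, h, -⟩ | ⟨h0, j, -, hmin, h⟩
  · cases h
  rcases h with ⟨-, h, -⟩ | ⟨hy, hres, -, rfl⟩ | ⟨-, -, -, h, -⟩ | ⟨-, -, -, -, h, -⟩
  · cases h
  · have hnb := cg_no_breakdown (m := j) hH hε hM hζ hc h0 hg (fun l hl hlj =>
      ⟨fun h' => hmin l hl hlj (Or.inr (Or.inl h')),
        fun h' => hmin l hl hlj (Or.inr (Or.inr (Or.inl h')))⟩)
    have h1 := inner_r_y_eq_zero hH hnb.1 hnb.2 (le_refl j) le_rfl
    rw [cgIter_residual, inner_add_left, real_inner_comm] at h1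
    refine ⟨not_lt.1 hy, by linarith, ?_⟩
    rw [← cgIter_residual]
    exact hres.2
  · cases h
  · cases h

end CappedCG

/-! ### Diagonal scaling and the relative step size -/

section Scaling

variable {n : ℕ}

lemma supNorm_le_iff {c : ℝ} (hc : 0 ≤ c) (v : Vec n) : supNorm v ≤ c ↔ ∀ i, |v i| ≤ c := by
  rw [supNorm, pi_norm_le_iff_of_nonneg hc]; rfl

lemma supNorm_nonneg (v : Vec n) : 0 ≤ supNorm v := norm_nonneg _

lemma abs_le_supNorm (v : Vec n) (i : Fin n) : |v i| ≤ supNorm v :=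
  (supNorm_le_iff (supNorm_nonneg v) v).1 le_rfl i

lemma abs_le_norm (v : Vec n) (i : Fin n) : |v i| ≤ ‖v‖ := by
  have := EuclideanSpace.norm_sq_eq v
  refine abs_le_of_sq_le_sq' ?_ (norm_nonneg v) |> abs_le.2
  rw [this]
  have h := Finset.single_le_sum (f := fun i => ‖v i‖ ^ 2) (fun i _ => by positivity)
    (Finset.mem_univ i)
  simpa using h

lemma supNorm_le_norm (v : Vec n) : supNorm v ≤ ‖v‖ :=
  (supNorm_le_iff (norm_nonneg v) v).2 (abs_le_norm v)

lemma inner_eq_sum (u v : Vec n) : ⟪u, v⟫_ℝ = ∑ i, u i * v i := by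
  simp [PiLp.inner_apply, mul_comm]

lemma norm_le_of_abs_le {u v : Vec n} (h : ∀ i, |u i| ≤ |v i|) : ‖u‖ ≤ ‖v‖ := by
  rw [EuclideanSpace.norm_eq, EuclideanSpace.norm_eq]
  refine Real.sqrt_le_sqrt (Finset.sum_le_sum fun i _ => ?_)
  exact pow_le_pow_left₀ (norm_nonneg _) (h i) 2

lemma diagMap_apply (v w : Vec n) (i : Fin n) : diagMap v w i = v i * w i := by
  simp [diagMap, Matrix.mulVec_diagonal]

lemma Xbar_apply (x w : Vec n) (i : Fin n) : Xbar x w i = min (x i) 1 * w i := by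
  rw [Xbar, diagMap_apply]; rfl

lemma inner_Xbar (x u v : Vec n) : ⟪Xbar x u, v⟫_ℝ = ⟪u, Xbar x v⟫_ℝ := by
  simp only [inner_eq_sum, Xbar_apply]
  exact Finset.sum_congr rfl fun i _ => by ring

/-- The vector `X⁻¹ X̄ d`. -/
noncomputable def relVec (x d : Vec n) : Vec n := WithLp.toLp 2 fun i => (x i)⁻¹ * (Xbar x d) i

lemma relVec_apply (x d : Vec n) (i : Fin n) : relVec x d i = (x i)⁻¹ * (Xbar x d) i := rfl

lemma relSize_eq (x d : Vec n) : relSize x d = supNorm (relVec x d) := rfl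

lemma relSize_smul (x d : Vec n) (s : ℝ) : relSize x (s • d) = |s| * relSize x d := by
  have : relVec x (s • d) = s • relVec x d := by
    ext i; simp [relVec_apply]; ring
  rw [relSize_eq, this, relSize_eq, supNorm, supNorm, WithLp.ofLp_smul, norm_smul,
    Real.norm_eq_abs]

variable {x : Vec n}

lemma norm_Xbar_le (hx : ∀ i, 0 < x i) (d : Vec n) : ‖Xbar x d‖ ≤ ‖d‖ := by
  refine norm_le_of_abs_le fun i => ?_
  have h0 : 0 < min (x i) 1 := lt_min (hx i) one_pos
  rw [Xbar_apply, abs_mul, abs_of_pos h0]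
  exact mul_le_of_le_one_left (abs_nonneg _) (min_le_right _ _)

lemma abs_relVec_le (hx : ∀ i, 0 < x i) (d : Vec n) (i : Fin n) : |relVec x d i| ≤ |d i| := by
  have h0 : 0 < min (x i) 1 := lt_min (hx i) one_pos
  rw [relVec_apply, Xbar_apply, ← mul_assoc, abs_mul, abs_of_pos (by have := hx i; positivity)]
  refine mul_le_of_le_one_left (abs_nonneg _) ?_
  rw [inv_mul_le_iff₀ (hx i), mul_one]
  exact min_le_left _ _

lemma norm_relVec_le (hx : ∀ i, 0 < x i) (d : Vec n) : ‖relVec x d‖ ≤ ‖d‖ :=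
  norm_le_of_abs_le (abs_relVec_le hx d)

lemma relSize_le_norm (hx : ∀ i, 0 < x i) (d : Vec n) : relSize x d ≤ ‖d‖ :=
  (supNorm_le_norm _).trans (norm_relVec_le hx d)

lemma relSize_pos (hx : ∀ i, 0 < x i) {d : Vec n} (hd : d ≠ 0) : 0 < relSize x d := by
  obtain ⟨i, hi⟩ : ∃ i, d i ≠ 0 := by
    by_contra! h
    exact hd (by ext i; simpa using h i)
  refine lt_of_lt_of_le ?_ (abs_le_supNorm (relVec x d) i)
  have h0 : 0 < min (x i) 1 := lt_min (hx i) one_pos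
  rw [relVec_apply, Xbar_apply, abs_pos]
  exact mul_ne_zero (inv_ne_zero (hx i).ne') (mul_ne_zero h0.ne' hi)

lemma add_smul_Xbar_apply (hx : ∀ i, 0 < x i) (d : Vec n) (a : ℝ) (i : Fin n) :
    (x + a • Xbar x d) i = x i * (1 + a * relVec x d i) := by
  have := (hx i).ne'
  rw [relVec_apply]
  simp only [PiLp.add_apply, PiLp.smul_apply, smul_eq_mul]
  field_simp

lemma add_smul_Xbar_pos (hx : ∀ i, 0 < x i) {d : Vec n} {β a : ℝ} (hd : relSize x d ≤ β)
    (hβ : β < 1) (ha0 : 0 ≤ a) (ha1 : a ≤ 1) (i : Fin n) : 0 < (x + a • Xbar x d) i := by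
  rw [add_smul_Xbar_apply hx]
  refine mul_pos (hx i) ?_
  have h1 := (abs_le_supNorm (relVec x d) i).trans hd
  have h2 : |a * relVec x d i| ≤ |relVec x d i| := by
    rw [abs_mul, abs_of_nonneg ha0]; exact mul_le_of_le_one_left (abs_nonneg _) ha1
  have h3 := neg_abs_le (a * relVec x d i)
  linarith

end Scaling

/-! ### Taylor estimates from the Lipschitz Hessian -/

section Taylor

variable {n : ℕ} {f : Vec n → ℝ} {x : Vec n}

lemma hasFDerivAt_gradient (hf : ContDiffAt ℝ 2 f x) :
    HasFDerivAt (gradient f) (hess f x) x := by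
  have h1 : DifferentiableAt ℝ (fderiv ℝ f) x :=
    (hf.fderiv_right (m := 1) (by norm_num)).differentiableAt (by norm_num)
  have h2 : DifferentiableAt ℝ (gradient f) x :=
    ((InnerProductSpace.toDual ℝ (Vec n)).symm.differentiableAt).comp x h1
  exact h2.hasFDerivAt

lemma inner_hess (hf : ContDiffAt ℝ 2 f x) (u v : Vec n) :
    ⟪hess f x u, v⟫_ℝ = fderiv ℝ (fderiv ℝ f) x u v := by
  have h1 : DifferentiableAt ℝ (fderiv ℝ f) x :=
    (hf.fderiv_right (m := 1) (by norm_num)).differentiableAt (by norm_num)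
  have h2 : HasFDerivAt (gradient f) _ x :=
    ((InnerProductSpace.toDual ℝ (Vec n)).symm.toContinuousLinearEquiv.hasFDerivAt).comp x
      h1.hasFDerivAt
  rw [hess, h2.fderiv]
  exact InnerProductSpace.toDual_symm_apply

lemma hess_symm (hf : ContDiffAt ℝ 2 f x) (u v : Vec n) :
    ⟪hess f x u, v⟫_ℝ = ⟪u, hess f x v⟫_ℝ := by
  rw [inner_hess hf, real_inner_comm, inner_hess hf]
  exact (hf.isSymmSndFDerivAt (by simp)).eq u v

variable {U : Set (Vec n)} {LH : ℝ}

lemma LipschitzHessianOn.contDiffAt (hU : LipschitzHessianOn f U LH) (hx : x ∈ U) :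
    ContDiffAt ℝ 2 f x := hU.contDiffOn.contDiffAt (hU.isOpen.mem_nhds hx)

lemma hasDerivAt_line (x s : Vec n) (t : ℝ) : HasDerivAt (fun t : ℝ => x + t • s) s t := by
  simpa using ((hasDerivAt_id t).smul_const s).const_add x

lemma mem_of_segment {s : Vec n} (hseg : segment ℝ x (x + s) ⊆ U) {t : ℝ}
    (h0 : 0 ≤ t) (h1 : t ≤ 1) : x + t • s ∈ U := by
  refine hseg ?_
  rw [segment_eq_image']
  exact ⟨t, ⟨h0, h1⟩, by simp⟩

/-- The derivative of the error in t is bounded by L_H ‖s‖² t. The parameter is kept general because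
`taylor_line` integrates this bound once more. -/
lemma gradient_taylor_line (hU : LipschitzHessianOn f U LH) {s : Vec n}
    (hseg : segment ℝ x (x + s) ⊆ U) {t : ℝ} (h0 : 0 ≤ t) (h1 : t ≤ 1) :
    ‖gradient f (x + t • s) - gradient f x - t • hess f x s‖ ≤ LH * ‖s‖ ^ 2 * (t ^ 2 / 2) := by
  have hd : ∀ r ∈ Set.Icc (0 : ℝ) 1,
      HasDerivAt (fun r : ℝ => gradient f (x + r • s) - gradient f x - r • hess f x s)
        (hess f (x + r • s) s - hess f x s) r := by
    intro r hr
    have h2 := (hasFDerivAt_gradient (hU.contDiffAt (mem_of_segment hseg hr.1 hr.2)))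
    have h3 := h2.comp_hasDerivAt r (hasDerivAt_line x s r)
    have h4 : HasDerivAt (fun r : ℝ => r • hess f x s) (hess f x s) r := by
      simpa using (hasDerivAt_id r).smul_const (hess f x s)
    exact (h3.sub_const _).sub h4
  refine image_norm_le_of_norm_deriv_right_le_deriv_boundary (a := 0) (b := 1)
    (B := fun r => LH * ‖s‖ ^ 2 * (r ^ 2 / 2)) (B' := fun r => LH * ‖s‖ ^ 2 * r)
    (fun r hr => (hd r hr).continuousAt.continuousWithinAt)
    (fun r hr => (hd r ⟨hr.1, hr.2.le⟩).hasDerivWithinAt) (by simp) ?_ ?_ ⟨h0, h1⟩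
  · intro r
    exact (((hasDerivAt_pow 2 r).div_const 2).const_mul (LH * ‖s‖ ^ 2)).congr_deriv (by simp)
  · intro r hr
    rw [← sub_apply]
    have hx0 : x ∈ U := hseg (left_mem_segment ℝ _ _)
    have h2 := hU.lipschitz _ (mem_of_segment hseg hr.1 hr.2.le) _ hx0
    rw [add_sub_cancel_left, norm_smul, Real.norm_eq_abs, abs_of_nonneg hr.1] at h2
    refine ((hess f (x + r • s) - hess f x).le_opNorm s).trans ?_
    have := mul_le_mul_of_nonneg_right h2 (norm_nonneg s)
    nlinarith

lemma gradient_taylor (hU : LipschitzHessianOn f U LH) {s : Vec n}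
    (hseg : segment ℝ x (x + s) ⊆ U) :
    ‖gradient f (x + s) - gradient f x - hess f x s‖ ≤ LH / 2 * ‖s‖ ^ 2 := by
  have := gradient_taylor_line hU hseg zero_le_one le_rfl
  simp only [one_smul] at this
  linarith

lemma taylor_line (hU : LipschitzHessianOn f U LH) {s : Vec n}
    (hseg : segment ℝ x (x + s) ⊆ U) {t : ℝ} (h0 : 0 ≤ t) (h1 : t ≤ 1) :
    f (x + t • s) ≤ f x + t * ⟪gradient f x, s⟫_ℝ + t ^ 2 / 2 * ⟪s, hess f x s⟫_ℝ +
      LH / 6 * t ^ 3 * ‖s‖ ^ 3 := by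
  have hd : ∀ r ∈ Set.Icc (0 : ℝ) 1,
      HasDerivAt (fun r : ℝ => f (x + r • s) - f x - r * ⟪gradient f x, s⟫_ℝ -
          r ^ 2 / 2 * ⟪s, hess f x s⟫_ℝ)
        ⟪gradient f (x + r • s) - gradient f x - r • hess f x s, s⟫_ℝ r := by
    intro r hr
    have h2 := ((hU.contDiffAt (mem_of_segment hseg hr.1 hr.2)).differentiableAt
      (by norm_num)).hasGradientAt.hasFDerivAt
    have h3 := h2.comp_hasDerivAt r (hasDerivAt_line x s r)
    have h4 : HasDerivAt (fun r : ℝ => r * ⟪gradient f x, s⟫_ℝ) ⟪gradient f x, s⟫_ℝ r := by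
      simpa using (hasDerivAt_id r).mul_const ⟪gradient f x, s⟫_ℝ
    have h5 : HasDerivAt (fun r : ℝ => r ^ 2 / 2 * ⟪s, hess f x s⟫_ℝ)
        (r * ⟪s, hess f x s⟫_ℝ) r := by
      exact (((hasDerivAt_pow 2 r).div_const 2).mul_const ⟪s, hess f x s⟫_ℝ).congr_deriv (by simp)
    refine (((h3.sub_const _).sub h4).sub h5).congr_deriv ?_
    rw [inner_sub_left, inner_sub_left, inner_smul_left, real_inner_comm s (hess f x s)]
    simp
  have := image_norm_le_of_norm_deriv_right_le_deriv_boundary (a := 0) (b := 1)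
    (B := fun r => LH / 6 * r ^ 3 * ‖s‖ ^ 3) (B' := fun r => LH * ‖s‖ ^ 2 * (r ^ 2 / 2) * ‖s‖)
    (fun r hr => (hd r hr).continuousAt.continuousWithinAt)
    (fun r hr => (hd r ⟨hr.1, hr.2.le⟩).hasDerivWithinAt) (by simp) ?_ ?_ ⟨h0, h1⟩
  · have := (le_abs_self _).trans this
    linarith
  · intro r
    refine (((hasDerivAt_pow 3 r).const_mul (LH / 6)).mul_const (‖s‖ ^ 3)).congr_deriv ?_
    simp; ring
  · intro r hr
    refine (norm_inner_le_norm _ _).trans ?_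
    exact mul_le_mul_of_nonneg_right (gradient_taylor_line hU hseg hr.1 hr.2.le) (norm_nonneg s)

end Taylor

/-! ### Derivatives and cubic upper model of the log-barrier function -/

section Barrier

variable {n : ℕ} {f : Vec n → ℝ} {x : Vec n} {μ : ℝ}

/-- The vector `x⁻¹`. -/
noncomputable def invVec (x : Vec n) : Vec n := WithLp.toLp 2 fun i => (x i)⁻¹

lemma hasGradientAt_barrier (hf : DifferentiableAt ℝ f x) (hx : ∀ i, 0 < x i) :
    HasGradientAt (barrier f μ) (gradient f x - μ • invVec x) x := by
  rw [hasGradientAt_iff_hasFDerivAt]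
  have h1 := hf.hasGradientAt.hasFDerivAt
  have h2 : ∀ i ∈ Finset.univ, HasFDerivAt (fun y : Vec n => Real.log (y i))
      ((x i)⁻¹ • (EuclideanSpace.proj i : Vec n →L[ℝ] ℝ)) x := fun i _ =>
    HasFDerivAt.log (EuclideanSpace.proj i : Vec n →L[ℝ] ℝ).hasFDerivAt (hx i).ne'
  have h3 := h1.sub ((HasFDerivAt.fun_sum h2).const_mul μ)
  refine h3.congr_fderiv ?_
  ext w
  simp only [sub_apply, InnerProductSpace.toDual_apply_apply, inner_sub_left,
    inner_smul_left]
  rw [inner_eq_sum (invVec x)]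
  simp [invVec]

lemma hasFDerivAt_invVec (hx : ∀ i, 0 < x i) :
    HasFDerivAt (invVec (n := n)) (-diagMap (WithLp.toLp 2 fun i => (x i ^ 2)⁻¹)) x := by
  rw [← hasFDerivWithinAt_univ, hasFDerivWithinAt_euclidean]
  intro i
  rw [hasFDerivWithinAt_univ]
  have h1 : HasFDerivAt (fun y : Vec n => y i) (EuclideanSpace.proj i : Vec n →L[ℝ] ℝ) x :=
    (EuclideanSpace.proj i : Vec n →L[ℝ] ℝ).hasFDerivAt
  have h2 := (hasDerivAt_inv (hx i).ne').comp_hasFDerivAt x h1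
  refine h2.congr_fderiv ?_
  ext w
  simp [diagMap_apply]

lemma hess_barrier (hf : ContDiffAt ℝ 2 f x) (hx : ∀ i, 0 < x i) :
    hess (barrier f μ) x = hess f x + μ • diagMap (WithLp.toLp 2 fun i => (x i ^ 2)⁻¹) := by
  -- The Hessian differentiates the gradient, so the gradient formula is needed on a neighbourhood,
  -- where positivity and smoothness persist.
  have hev : gradient (barrier f μ) =ᶠ[nhds x] fun y => gradient f y - μ • invVec y := by
    have h1 : ∀ᶠ y in nhds x, ∀ i, 0 < y i := by
      rw [Filter.eventually_all]
      intro i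
      exact (EuclideanSpace.proj i : Vec n →L[ℝ] ℝ).continuous.continuousAt.eventually
        (lt_mem_nhds (hx i))
    filter_upwards [h1, hf.eventually (by simp)] with y hy hfy
    exact (hasGradientAt_barrier (hfy.differentiableAt (by norm_num)) hy).gradient
  rw [hess, hev.fderiv_eq]
  have := (hasFDerivAt_gradient hf).sub ((hasFDerivAt_invVec hx).const_smul μ)
  exact this.fderiv.trans (by simp)

lemma gradient_barrier_apply (hf : ContDiffAt ℝ 2 f x) (hx : ∀ i, 0 < x i) (i : Fin n) :
    gradient (barrier f μ) x i = gradient f x i - μ * (x i)⁻¹ := by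
  rw [(hasGradientAt_barrier (hf.differentiableAt (by norm_num)) hx).gradient]
  simp [invVec]

lemma scaledGrad_barrier_apply (hf : ContDiffAt ℝ 2 f x) (hx : ∀ i, 0 < x i) (i : Fin n) :
    scaledGrad (barrier f μ) x i = min (x i) 1 * (gradient f x i - μ * (x i)⁻¹) := by
  rw [scaledGrad, Xbar_apply, gradient_barrier_apply hf hx]

lemma scaledHess_barrier_apply (hf : ContDiffAt ℝ 2 f x) (hx : ∀ i, 0 < x i) (d : Vec n)
    (i : Fin n) : scaledHess (barrier f μ) x d i = min (x i) 1 * (hess f x (Xbar x d) i +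
      μ * (x i)⁻¹ * relVec x d i) := by
  have := (hx i).ne'
  rw [scaledHess, hess_barrier hf hx]
  simp only [ContinuousLinearMap.comp_apply, Xbar_apply, add_apply,
    smul_apply, PiLp.add_apply, PiLp.smul_apply, smul_eq_mul, diagMap_apply,
    relVec_apply]
  field_simp

lemma scaledHess_barrier_symm (hf : ContDiffAt ℝ 2 f x) (hx : ∀ i, 0 < x i) (u v : Vec n) :
    ⟪scaledHess (barrier f μ) x u, v⟫_ℝ = ⟪u, scaledHess (barrier f μ) x v⟫_ℝ := by
  simp only [scaledHess, ContinuousLinearMap.comp_apply, inner_Xbar]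
  rw [hess_barrier hf hx, ← inner_Xbar x u]
  simp only [add_apply, smul_apply, inner_add_left,
    inner_add_right, inner_smul_left, inner_smul_right, hess_symm hf]
  congr 1
  simp only [inner_eq_sum, diagMap_apply, conj_trivial]
  congr 1
  exact Finset.sum_congr rfl fun i _ => by ring

lemma inner_scaledGrad_barrier (hf : ContDiffAt ℝ 2 f x) (hx : ∀ i, 0 < x i) (d : Vec n) :
    ⟪scaledGrad (barrier f μ) x, d⟫_ℝ = ⟪gradient f x, Xbar x d⟫_ℝ - μ * ∑ i, relVec x d i := by
  rw [inner_eq_sum, inner_eq_sum, Finset.mul_sum, ← Finset.sum_sub_distrib]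
  refine Finset.sum_congr rfl fun i _ => ?_
  rw [scaledGrad_barrier_apply hf hx, relVec_apply, Xbar_apply]
  ring

lemma inner_scaledHess_barrier (hf : ContDiffAt ℝ 2 f x) (hx : ∀ i, 0 < x i) (d : Vec n) :
    ⟪d, scaledHess (barrier f μ) x d⟫_ℝ =
      ⟪Xbar x d, hess f x (Xbar x d)⟫_ℝ + μ * ∑ i, relVec x d i ^ 2 := by
  rw [inner_eq_sum, inner_eq_sum, Finset.mul_sum, ← Finset.sum_add_distrib]
  refine Finset.sum_congr rfl fun i _ => ?_
  rw [scaledHess_barrier_apply hf hx, relVec_apply, Xbar_apply]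
  ring

lemma inner_scaledHess (x d : Vec n) :
    ⟪d, scaledHess f x d⟫_ℝ = ⟪Xbar x d, hess f x (Xbar x d)⟫_ℝ := by
  rw [scaledHess, ContinuousLinearMap.comp_apply, ContinuousLinearMap.comp_apply, inner_Xbar]

lemma sum_relVec_sq_le (hx : ∀ i, 0 < x i) (d : Vec n) :
    ∑ i, relVec x d i ^ 2 ≤ ‖d‖ ^ 2 := by
  have h1 := pow_le_pow_left₀ (norm_nonneg _) (norm_relVec_le hx d) 2
  rw [EuclideanSpace.norm_sq_eq] at h1
  simpa using h1

/-- Truncate the logarithmic series after two terms. The uniform remainder is where β < 1, the bound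
on the relative step, enters the cubic model. -/
lemma neg_log_one_add_le {u β : ℝ} (hu : |u| ≤ β) (hβ : β < 1) :
    -Real.log (1 + u) ≤ -u + u ^ 2 / 2 + |u| ^ 3 / (1 - β) := by
  have h := Real.abs_log_sub_add_sum_range_le (x := -u) (by rw [abs_neg]; linarith) 2
  simp only [Finset.sum_range_succ, Finset.sum_range_zero, abs_neg] at h
  norm_num at h
  have h1 := (abs_le.1 h).1
  have h2 : |u| ^ 3 / (1 - |u|) ≤ |u| ^ 3 / (1 - β) := by
    gcongr
  linarith

lemma sum_abs_relVec_cube_le (hx : ∀ i, 0 < x i) (d : Vec n) :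
    ∑ i, |relVec x d i| ^ 3 ≤ ‖d‖ ^ 3 := by
  have h1 : ∀ i ∈ Finset.univ, |relVec x d i| ^ 3 ≤ relVec x d i ^ 2 * ‖d‖ := by
    intro i _
    have h2 := (abs_le_norm (relVec x d) i).trans (norm_relVec_le hx d)
    have h3 : |relVec x d i| ^ 3 = relVec x d i ^ 2 * |relVec x d i| := by
      rw [← sq_abs]; ring
    rw [h3]
    exact mul_le_mul_of_nonneg_left h2 (sq_nonneg _)
  refine (Finset.sum_le_sum h1).trans ?_
  rw [← Finset.sum_mul]
  have := mul_le_mul_of_nonneg_right (sum_relVec_sq_le hx d) (norm_nonneg d)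
  nlinarith

/-- The third-order upper model of the log-barrier function along a scaled direction. -/
lemma barrier_le_model {U : Set (Vec n)} {LH β : ℝ} (hU : LipschitzHessianOn f U LH)
    (hLH : 0 ≤ LH) (hμ : 0 ≤ μ) (hx : ∀ i, 0 < x i) {d : Vec n}
    (hseg : segment ℝ x (x + Xbar x d) ⊆ U) (hd : relSize x d ≤ β) (hβ : β < 1) {a : ℝ}
    (ha0 : 0 ≤ a) (ha1 : a ≤ 1) :
    barrier f μ (x + a • Xbar x d) ≤ barrier f μ x + a * ⟪scaledGrad (barrier f μ) x, d⟫_ℝ +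
      a ^ 2 / 2 * ⟪d, scaledHess (barrier f μ) x d⟫_ℝ +
      a ^ 3 / 6 * (LH + 6 * μ / (1 - β)) * ‖d‖ ^ 3 := by
  have hf := hU.contDiffAt (hseg (left_mem_segment ℝ _ _))
  rw [inner_scaledGrad_barrier hf hx, inner_scaledHess_barrier hf hx]
  have h1 := taylor_line hU hseg ha0 ha1
  have h2 : LH / 6 * a ^ 3 * ‖Xbar x d‖ ^ 3 ≤ LH / 6 * a ^ 3 * ‖d‖ ^ 3 := by
    have := norm_Xbar_le hx d
    gcongr
  have hlog : ∀ i ∈ Finset.univ, -Real.log ((x + a • Xbar x d) i) ≤ -Real.log (x i) -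
      a * relVec x d i + a ^ 2 / 2 * relVec x d i ^ 2 +
        a ^ 3 / (1 - β) * |relVec x d i| ^ 3 := by
    intro i _
    have h3 := (abs_le_supNorm (relVec x d) i).trans hd
    have h4 : |a * relVec x d i| ≤ β := by
      rw [abs_mul, abs_of_nonneg ha0]
      exact (mul_le_of_le_one_left (abs_nonneg _) ha1).trans h3
    have h5 : 0 < 1 + a * relVec x d i := by
      have := neg_abs_le (a * relVec x d i); linarith
    rw [add_smul_Xbar_apply hx, Real.log_mul (hx i).ne' h5.ne']
    have h6 := neg_log_one_add_le h4 hβ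
    rw [abs_mul, abs_of_nonneg ha0, mul_pow, mul_pow] at h6
    have : a ^ 3 / (1 - β) * |relVec x d i| ^ 3 = a ^ 3 * |relVec x d i| ^ 3 / (1 - β) := by ring
    rw [this]
    linarith
  have h7 := Finset.sum_le_sum hlog
  simp only [Finset.sum_add_distrib, Finset.sum_sub_distrib, Finset.sum_neg_distrib,
    ← Finset.mul_sum] at h7
  have h8 : a ^ 3 / (1 - β) * ∑ i, |relVec x d i| ^ 3 ≤ a ^ 3 / (1 - β) * ‖d‖ ^ 3 := by
    refine mul_le_mul_of_nonneg_left (sum_abs_relVec_cube_le hx d) ?_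
    have : 0 < 1 - β := by linarith
    positivity
  have h9 := mul_le_mul_of_nonneg_left (h7.trans (add_le_add_right h8 _)) hμ
  have e : a ^ 3 / 6 * (LH + 6 * μ / (1 - β)) * ‖d‖ ^ 3 =
      LH / 6 * a ^ 3 * ‖d‖ ^ 3 + μ * (a ^ 3 / (1 - β) * ‖d‖ ^ 3) := by ring
  simp only [barrier]
  rw [e]
  linarith

end Barrier

/-! ### The constants of the step length bounds -/

section Constants

/-- The coefficient of the cubic term that the line search has to dominate. -/
noncomputable def cubicCoeff (LH β η : ℝ) : ℝ := LH + η + (2 - β) / (1 - β) ^ 2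

variable {LH θ ζr ζbar β η : ℝ}

lemma cubicCoeff_pos (hL : 0 < LH) (hη : 0 < η) (hβ : β < 1) : 0 < cubicCoeff LH β η := by
  have h1 : 0 < 1 - β := by linarith
  have h2 : 0 < 2 - β := by linarith
  rw [cubicCoeff]; positivity

lemma div_cubicCoeff (hL : 0 < LH) (hη : 0 < η) (hβ : β < 1) (s : ℝ) :
    s * (1 - β) ^ 2 / ((LH + η) * (1 - β) ^ 2 + (2 - β)) = s / cubicCoeff LH β η := by
  have h1 : 0 < 1 - β := by linarith
  have h2 : 0 < 2 - β := by linarith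
  have h3 := cubicCoeff_pos hL hη hβ
  have h4 : (LH + η) * (1 - β) ^ 2 + (2 - β) = cubicCoeff LH β η * (1 - β) ^ 2 := by
    rw [cubicCoeff]; field_simp
  rw [h4]
  field_simp

lemma call_le_one : call LH θ ζr ζbar β η ≤ 1 := (min_le_right _ _).trans (min_le_left _ _)

lemma call_le_cd : call LH θ ζr ζbar β η ≤ cd LH ζr ζbar :=
  (min_le_left _ _).trans (min_le_left _ _)

lemma call_le_sol (hL : 0 < LH) (hη : 0 < η) (hβ : β < 1) :
    call LH θ ζr ζbar β η ≤ 6 * θ ^ 2 / cubicCoeff LH β η := by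
  refine ((min_le_left _ _).trans (min_le_right _ _)).trans (le_of_eq ?_)
  rw [← div_cubicCoeff hL hη hβ]; ring

lemma call_le_nc (hL : 0 < LH) (hη : 0 < η) (hβ : β < 1) :
    call LH θ ζr ζbar β η ≤ 3 * θ / cubicCoeff LH β η := by
  refine ((min_le_right _ _).trans (min_le_right _ _)).trans (le_of_eq ?_)
  rw [← div_cubicCoeff hL hη hβ]; ring

lemma call_pos (hL : 0 < LH) (hη : 0 < η) (hβ : β < 1) (hθ : 0 < θ) (hζr : 0 < ζr)
    (hζ : ζbar < 1) : 0 < call LH θ ζr ζbar β η := by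
  have h1 : 0 < 1 - β := by linarith
  have h2 : 0 < 2 - β := by linarith
  have h3 : 0 < 1 - ζbar := by linarith
  have h4 : 0 < √(3 / (2 * LH)) := Real.sqrt_pos.2 (by positivity)
  simp only [call, csol, cnc, cd, lt_min_iff]
  refine ⟨⟨⟨?_, h4, ?_⟩, ?_⟩, one_pos, ?_⟩ <;> positivity

end Constants

namespace Params.Valid

variable {P : Params}

lemma εH_pos (hP : P.Valid) : 0 < P.εH := Real.sqrt_pos.2 hP.εg_pos

lemma εH_sq (hP : P.Valid) : P.εH ^ 2 = P.εg := Real.sq_sqrt hP.εg_pos.le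

lemma εH_lt_one (hP : P.Valid) : P.εH < 1 := by
  rw [Params.εH, Real.sqrt_lt' one_pos]; simpa using hP.εg_lt

lemma β_pos (hP : P.Valid) : 0 < P.β := hP.εH_pos.trans_le hP.β_ge

lemma μ_eq (hP : P.Valid) : P.μ = P.εH ^ 2 / 4 := by rw [hP.εH_sq]; rfl

lemma μ_pos (hP : P.Valid) : 0 < P.μ := by have := hP.εg_pos; rw [Params.μ]; positivity

lemma cμ_pos (hP : P.Valid) : 0 < P.cμ := mul_pos hP.ζbar_pos hP.μ_pos

lemma Mμ_nonneg (hP : P.Valid) : 0 ≤ P.Mμ := add_nonneg hP.Mhat_nonneg hP.μ_pos.le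

end Params.Valid

/-! ### Line search and lower bounds for the moves -/

section LineSearch

variable {n : ℕ} {P : Params} {f : Vec n → ℝ} {x d : Vec n} {U : Set (Vec n)} {LH : ℝ}

lemma accepts_of_model (hP : P.Valid) (hU : LipschitzHessianOn f U LH) (hL : 0 < LH)
    (hx : ∀ i, 0 < x i) (hseg : segment ℝ x (x + Xbar x d) ⊆ U) (hd : relSize x d ≤ P.β) {j : ℕ}
    (h : P.θ ^ j * ⟪scaledGrad (barrier f P.μ) x, d⟫_ℝ +
      (P.θ ^ j) ^ 2 / 2 * ⟪d, scaledHess (barrier f P.μ) x d⟫_ℝ +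
      (P.θ ^ j) ^ 3 / 6 * cubicCoeff LH P.β P.η * ‖d‖ ^ 3 < 0) : Accepts P f x d j := by
  have h1 := barrier_le_model hU hL.le hP.μ_pos.le hx hseg hd hP.β_lt
    (pow_nonneg hP.θ_pos.le j) (pow_le_one₀ hP.θ_pos.le hP.θ_lt.le)
  have hβ : 0 < 1 - P.β := by have := hP.β_lt; linarith
  have h2 : LH + 6 * P.μ / (1 - P.β) ≤ cubicCoeff LH P.β P.η - P.η := by
    -- Here 6μ = 3ε_g/2 < 3/2, and (3/2)(1 - β) ≤ 2 - β.
    have h3 : 6 * P.μ / (1 - P.β) ≤ (2 - P.β) / (1 - P.β) ^ 2 := by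
      rw [div_le_div_iff₀ hβ (by positivity), Params.μ]
      have := hP.εg_lt
      have h4 : 6 * (P.εg / 4) * (1 - P.β) ≤ 2 - P.β := by nlinarith [hP.β_pos]
      nlinarith
    rw [cubicCoeff]; linarith
  have h3 : 0 ≤ (P.θ ^ j) ^ 3 * ‖d‖ ^ 3 := by have := hP.θ_pos; positivity
  rw [Accepts]
  nlinarith [mul_le_mul_of_nonneg_left h2 h3]

/-- The quadratic term of the model is at most -a²‖d‖³/2, which beats the cubic term when a times
its coefficient is below 3. -/
lemma accepts_of_negative_curvature (hP : P.Valid) (hU : LipschitzHessianOn f U LH) (hL : 0 < LH)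
    (hx : ∀ i, 0 < x i) (hseg : segment ℝ x (x + Xbar x d) ⊆ U) (hd : relSize x d ≤ P.β)
    (hd0 : d ≠ 0) (hg : ⟪scaledGrad (barrier f P.μ) x, d⟫_ℝ ≤ 0)
    (hH : ⟪d, scaledHess (barrier f P.μ) x d⟫_ℝ ≤ -‖d‖ ^ 3) {j : ℕ}
    (hj : P.θ ^ j * cubicCoeff LH P.β P.η < 3) : Accepts P f x d j := by
  refine accepts_of_model hP hU hL hx hseg hd ?_
  have ha : 0 < P.θ ^ j := pow_pos hP.θ_pos j
  have h1 : 0 < (P.θ ^ j) ^ 2 * ‖d‖ ^ 3 := by have := norm_pos_iff.2 hd0; positivity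
  have h2 := mul_nonpos_of_nonneg_of_nonpos ha.le hg
  have h3 := mul_le_mul_of_nonneg_left hH (sq_nonneg (P.θ ^ j))
  have h4 := mul_lt_mul_of_pos_left hj h1
  nlinarith

/-- With Q = dᵀH̄d the first two model terms are at most -a(1 - a/2)Q - a²ε‖d‖², and the step length
condition bounds the cubic term by aε‖d‖². Since Q ≥ ε‖d‖², the sum is at most -a²ε‖d‖²/2. -/
lemma accepts_of_newton (hP : P.Valid) (hU : LipschitzHessianOn f U LH) (hL : 0 < LH)
    (hx : ∀ i, 0 < x i) (hseg : segment ℝ x (x + Xbar x d) ⊆ U) (hd : relSize x d ≤ P.β)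
    (hd0 : d ≠ 0)
    (hg : ⟪scaledGrad (barrier f P.μ) x, d⟫_ℝ ≤
      -⟪d, damped (scaledHess (barrier f P.μ) x) P.εH d⟫_ℝ)
    (hH : P.εH * ‖d‖ ^ 2 ≤ ⟪d, damped (scaledHess (barrier f P.μ) x) P.εH d⟫_ℝ) {j : ℕ}
    (hj : (P.θ ^ j) ^ 2 * cubicCoeff LH P.β P.η * ‖d‖ ≤ 6 * P.εH) : Accepts P f x d j := by
  refine accepts_of_model hP hU hL hx hseg hd ?_
  rw [inner_damped] at hg hH
  have ha : 0 < P.θ ^ j := pow_pos hP.θ_pos j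
  have ha1 : P.θ ^ j ≤ 1 := pow_le_one₀ hP.θ_pos.le hP.θ_lt.le
  have hε := hP.εH_pos
  have hdn := norm_pos_iff.2 hd0
  generalize P.θ ^ j = a at *
  generalize ⟪d, scaledHess (barrier f P.μ) x d⟫_ℝ = q at *
  have h1 := mul_le_mul_of_nonneg_left hg ha.le
  have h2 := mul_le_mul_of_nonneg_left hj (by positivity : 0 ≤ a * ‖d‖ ^ 2 / 6)
  have h3 := mul_le_mul_of_nonneg_left hH (by nlinarith : 0 ≤ a * (1 - a / 2))
  have h4 : 0 < a ^ 2 * (P.εH * ‖d‖ ^ 2) := by positivity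
  nlinarith

lemma exists_pow_mul_lt (hP : P.Valid) {K c : ℝ} (hK : 0 < K) (hc : 0 < c) :
    ∃ j : ℕ, P.θ ^ j * K < c := by
  obtain ⟨j, hj⟩ := exists_pow_lt_of_lt_one (div_pos hc hK) hP.θ_lt
  exact ⟨j, (lt_div_iff₀ hK).1 hj⟩

lemma lineSearch_result {s' : State n} (h : LineSearch P f x d s') (hex : ∃ j, Accepts P f x d j) :
    ∃ j, Accepts P f x d j ∧ (∀ i < j, ¬ Accepts P f x d i) ∧
      s' = (.running, x + P.θ ^ j • Xbar x d) := by
  rcases h with ⟨j, hj, rfl⟩ | ⟨h, -⟩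
  · exact ⟨j, hj.1, fun i hij hi => absurd (hj.2 hi) (not_le.2 hij), rfl⟩
  · obtain ⟨j, hj⟩ := hex
    exact absurd hj (h j)

/-- The iteration moves from `x` to the positive point `x'` by at most `s`, with a decrease of
the log-barrier function by more than `η s³ / 6`. -/
structure GoodMove (P : Params) (f : Vec n → ℝ) (x x' : Vec n) (s : ℝ) : Prop where
  pos : ∀ i, 0 < x' i
  nonneg : 0 ≤ s
  dist : ‖x' - x‖ ≤ s
  decrease : P.η / 6 * s ^ 3 < barrier f P.μ x - barrier f P.μ x'

lemma goodMove_of_accepts (hP : P.Valid) (hx : ∀ i, 0 < x i) (hd : relSize x d ≤ P.β) {j : ℕ}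
    (h : Accepts P f x d j) : GoodMove P f x (x + P.θ ^ j • Xbar x d) (P.θ ^ j * ‖d‖) := by
  have ha : 0 < P.θ ^ j := pow_pos hP.θ_pos j
  refine ⟨add_smul_Xbar_pos hx hd hP.β_lt ha.le (pow_le_one₀ hP.θ_pos.le hP.θ_lt.le),
    by positivity, ?_, ?_⟩
  · rw [add_sub_cancel_left, norm_smul, Real.norm_eq_abs, abs_of_pos ha]
    exact mul_le_mul_of_nonneg_left (norm_Xbar_le hx d) ha.le
  · rw [Accepts] at h
    rw [mul_pow]
    linarith

lemma move_of_negative_curvature (hP : P.Valid) (hU : LipschitzHessianOn f U LH) (hL : 0 < LH)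
    (hx : ∀ i, 0 < x i) (hseg : segment ℝ x (x + Xbar x d) ⊆ U) (hd : relSize x d ≤ P.β)
    (hg : ⟪scaledGrad (barrier f P.μ) x, d⟫_ℝ ≤ 0)
    (hH : ⟪d, scaledHess (barrier f P.μ) x d⟫_ℝ ≤ -‖d‖ ^ 3)
    (hdε : P.εH / 4 ≤ ‖d‖) {s' : State n} (h : LineSearch P f x d s') :
    ∃ x' s, s' = (.running, x') ∧ GoodMove P f x x' s ∧
      call LH P.θ P.ζr P.ζbar P.β P.η * P.εH / 4 ≤ s := by
  have hε := hP.εH_pos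
  have hdn : 0 < ‖d‖ := by linarith
  have hd0 : d ≠ 0 := norm_pos_iff.1 hdn
  have hΛ := cubicCoeff_pos hL hP.η_pos hP.β_lt
  obtain ⟨j, hj, hmin, rfl⟩ := lineSearch_result h (by
    obtain ⟨j, hj⟩ := exists_pow_mul_lt hP hΛ three_pos
    exact ⟨j, accepts_of_negative_curvature hP hU hL hx hseg hd hd0 hg hH hj⟩)
  refine ⟨_, _, rfl, goodMove_of_accepts hP hx hd hj, ?_⟩
  have hc : call LH P.θ P.ζr P.ζbar P.β P.η ≤ P.θ ^ j := by
    cases j with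
    | zero => simpa using call_le_one
    | succ j =>
      -- The previous trial was rejected, so its step length violates the sufficient condition; one
      -- factor θ is lost.
      have h1 : ¬ P.θ ^ j * cubicCoeff LH P.β P.η < 3 := fun h' =>
        hmin j (by omega) (accepts_of_negative_curvature hP hU hL hx hseg hd hd0 hg hH h')
      refine (call_le_nc hL hP.η_pos hP.β_lt).trans ?_
      rw [div_le_iff₀ hΛ, pow_succ]
      nlinarith [hP.θ_pos]
  have h2 : 0 < P.θ ^ j := pow_pos hP.θ_pos j
  calc call LH P.θ P.ζr P.ζbar P.β P.η * P.εH / 4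
      = call LH P.θ P.ζr P.ζbar P.β P.η * (P.εH / 4) := by ring
    _ ≤ P.θ ^ j * (P.εH / 4) := by gcongr
    _ ≤ _ := by gcongr

/-- The first term of the minimum makes the curvature of d at most -‖d‖³, the second keeps the trial
points positive. If the first is active, ‖d‖ is the Rayleigh quotient in absolute value; if the
second is, ‖d‖ ≥ β. -/
lemma negative_curvature_scaling {H : Vec n →L[ℝ] Vec n} {g v : Vec n} {q β σ : ℝ}
    (hx : ∀ i, 0 < x i) (hβ : 0 < β) (hqβ : q ≤ β) (hq : 0 < q) (hv : v ≠ 0)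
    (hcurv : ⟪v, H v⟫_ℝ ≤ -(q * ‖v‖ ^ 2)) (hσ : IsSign σ ⟪g, v⟫_ℝ)
    (hd : d = (-σ * min (|⟪v, H v⟫_ℝ| / ‖v‖ ^ 3) (β / relSize x v)) • v) :
    relSize x d ≤ β ∧ ⟪g, d⟫_ℝ ≤ 0 ∧ ⟪d, H d⟫_ℝ ≤ -‖d‖ ^ 3 ∧ q ≤ ‖d‖ := by
  have hvn := norm_pos_iff.2 hv
  have hrel := relSize_pos hx hv
  have hneg : ⟪v, H v⟫_ℝ < 0 := by
    have : 0 < q * ‖v‖ ^ 2 := by positivity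
    linarith
  rw [abs_of_neg hneg] at hd
  set m := min (-⟪v, H v⟫_ℝ / ‖v‖ ^ 3) (β / relSize x v) with hm
  have hm0 : 0 < m := lt_min (div_pos (by linarith) (by positivity)) (by positivity)
  have hm1 : m * ‖v‖ ^ 3 ≤ -⟪v, H v⟫_ℝ := (le_div_iff₀ (by positivity)).1 (min_le_left _ _)
  have hm2 : m * relSize x v ≤ β := (le_div_iff₀ hrel).1 (min_le_right _ _)
  have hσ1 : |(-σ * m)| = m := by
    rw [abs_mul, abs_neg, abs_of_pos hm0]
    rcases hσ.1 with h | h <;> simp [h]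
  have hσ2 : (-σ * m) * (-σ * m) = m ^ 2 := by
    rcases hσ.1 with h | h <;> simp [h] <;> ring
  have hdn : ‖d‖ = m * ‖v‖ := by rw [hd, norm_smul, Real.norm_eq_abs, hσ1]
  refine ⟨?_, ?_, ?_, ?_⟩
  · rw [hd, relSize_smul, hσ1]; exact hm2
  · rw [hd, inner_smul_right]
    have : -σ * m * ⟪g, v⟫_ℝ = -(m * |⟪g, v⟫_ℝ|) := by rw [← hσ.2]; ring
    rw [this]
    have := abs_nonneg ⟪g, v⟫_ℝ
    have : 0 ≤ m * |⟪g, v⟫_ℝ| := by positivity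
    linarith
  · rw [hdn]
    have : ⟪d, H d⟫_ℝ = m ^ 2 * ⟪v, H v⟫_ℝ := by
      rw [hd, map_smul, inner_smul_left, inner_smul_right, ← hσ2]
      simp only [conj_trivial]; ring
    rw [this]
    have := mul_le_mul_of_nonneg_left hm1 (sq_nonneg m)
    nlinarith
  · rw [hdn]
    rcases min_choice (-⟪v, H v⟫_ℝ / ‖v‖ ^ 3) (β / relSize x v) with h | h
    · rw [hm, h, div_mul_eq_mul_div, le_div_iff₀ (by positivity)]
      nlinarith
    · rw [hm, h, div_mul_eq_mul_div, le_div_iff₀ hrel]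
      have := relSize_le_norm hx v
      nlinarith

lemma newton_scaling {H : Vec n →L[ℝ] Vec n} {g v : Vec n} {ε β : ℝ}
    (hx : ∀ i, 0 < x i) (hβ : 0 < β) (hε : 0 < ε) (hv : v ≠ 0)
    (hcurv : ε * ‖v‖ ^ 2 ≤ ⟪v, damped H ε v⟫_ℝ) (hg : ⟪g, v⟫_ℝ = -⟪v, damped H ε v⟫_ℝ)
    (hd : d = min 1 (β / relSize x v) • v) :
    relSize x d ≤ β ∧ d ≠ 0 ∧ ⟪g, d⟫_ℝ ≤ -⟪d, damped H ε d⟫_ℝ ∧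
      ε * ‖d‖ ^ 2 ≤ ⟪d, damped H ε d⟫_ℝ ∧ (d = v ∨ β ≤ ‖d‖) := by
  have hvn := norm_pos_iff.2 hv
  have hrel := relSize_pos hx hv
  set m := min 1 (β / relSize x v) with hm
  have hm0 : 0 < m := lt_min one_pos (by positivity)
  have hm1 : m ≤ 1 := min_le_left _ _
  have hm2 : m * relSize x v ≤ β := (le_div_iff₀ hrel).1 (min_le_right _ _)
  have hq : 0 ≤ ⟪v, damped H ε v⟫_ℝ := le_trans (by positivity) hcurv
  have hdn : ‖d‖ = m * ‖v‖ := by rw [hd, norm_smul, Real.norm_eq_abs, abs_of_pos hm0]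
  have hdd : ⟪d, damped H ε d⟫_ℝ = m ^ 2 * ⟪v, damped H ε v⟫_ℝ := by
    rw [hd, map_smul, inner_smul_left, inner_smul_right]
    simp only [conj_trivial]; ring
  refine ⟨?_, ?_, ?_, ?_, ?_⟩
  · rw [hd, relSize_smul, abs_of_pos hm0]; exact hm2
  · rw [hd]; exact smul_ne_zero hm0.ne' hv
  · rw [hdd, hd, inner_smul_right, hg]
    -- Scaling by m ≤ 1 multiplies the linear term by m and the curvature by m² ≤ m, so the equality
    -- becomes the needed inequality.
    nlinarith [mul_nonneg hm0.le hq]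
  · rw [hdd, hdn]
    nlinarith [mul_le_mul_of_nonneg_left hcurv (sq_nonneg m)]
  · rcases min_choice 1 (β / relSize x v) with h | h
    · left; rw [hd, hm, h, one_smul]
    · right
      rw [hdn, hm, h, div_mul_eq_mul_div, le_div_iff₀ hrel]
      exact mul_le_mul_of_nonneg_left (relSize_le_norm hx v) hβ.le

/-- One coordinate of the short Newton step: y is the old coordinate, t its relative change, b the
linear prediction of the new gradient entry and G its actual value. The Newton residual confines
min(y, 1) b between multiples of μ; the rest is to pass to G and to the new scaling factor. -/
lemma short_newton_coordinate {ε μ ζ D y b G t w u : ℝ} (hε : 0 < ε) (hζ : 0 < ζ) (hζ1 : ζ < 1)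
    (hμ : μ = ε ^ 2 / 4) (hD : D ≤ ε / 9) (hε1 : ε < 1) (hμD : (μ + 2 * ε) * D ≤ (1 - ζ) * μ)
    (hy : 0 < y) (ht : |t| ≤ D) (hw : |w| ≤ D)
    (hu : u = min y 1 * y⁻¹)
    (h1 : -(ζ * μ) ≤ min y 1 * b - μ * u * (1 - t) + 2 * ε * w)
    (h2 : min y 1 * b - μ * u * (1 - t) + 2 * ε * w ≤ ζ * μ)
    (hG1 : b - ε ^ 2 / 36 ≤ G) (hG2 : G ≤ b + ε ^ 2 / 36) :
    -ε ^ 2 < G ∧ |min (y * (1 + t)) 1 * G| ≤ ε ^ 2 := by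
  have ht' := abs_le.1 ht
  have hw' := abs_le.1 hw
  have hD0 : 0 ≤ D := (abs_nonneg t).trans ht
  have hμ0 : 0 < μ := by rw [hμ]; positivity
  have hε2 : 0 < ε ^ 2 := by positivity
  have hm0 : 0 < min y 1 := lt_min hy one_pos
  have hu0 : 0 < u := by rw [hu]; positivity
  have hu1 : u ≤ 1 := by
    rw [hu, mul_inv_le_iff₀ hy, one_mul]; exact min_le_left _ _
  have hεw1 : ε * w ≤ ε * D := mul_le_mul_of_nonneg_left hw'.2 hε.le
  have hεw2 : ε * -D ≤ ε * w := mul_le_mul_of_nonneg_left hw'.1 hε.le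
  -- For y ≤ 1 the barrier term has full weight μ and outweighs all errors, so b ≥ 0. For y ≥ 1 the
  -- scaling factor is 1, and the residual inequality bounds b directly.
  have hblow : -(ε ^ 2 / 4) ≤ b := by
    rcases le_total y 1 with h | h
    · have hu' : u = 1 := by rw [hu, min_eq_left h, mul_inv_cancel₀ hy.ne']
      rw [hu'] at h1
      have h3 : 0 ≤ min y 1 * b := by
        have : μ * t ≤ μ * D := mul_le_mul_of_nonneg_left ht'.2 hμ0.le
        linarith
      have h4 : 0 ≤ b := nonneg_of_mul_nonneg_right h3 hm0
      linarith
    · rw [min_eq_right h, one_mul] at h1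
      have h3 : 0 ≤ μ * u * (1 - t) := mul_nonneg (by positivity) (by linarith)
      have h4 : 0 ≤ μ * D := by positivity
      linarith
  have hGlow : -ε ^ 2 < G := by linarith
  refine ⟨hGlow, ?_⟩
  obtain ⟨m, hm⟩ : ∃ m, m = min (y * (1 + t)) 1 := ⟨_, rfl⟩
  rw [← hm]
  have hm'0 : 0 < m := by rw [hm]; exact lt_min (mul_pos hy (by linarith)) one_pos
  have hm'1 : m ≤ 1 := by rw [hm]; exact min_le_right _ _
  have hm'2 : m ≤ (1 + D) * min y 1 := by
    rcases le_total y 1 with h | h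
    · rw [min_eq_left h, hm, mul_comm (1 + D)]
      exact (min_le_left _ _).trans (mul_le_mul_of_nonneg_left (by linarith) hy.le)
    · rw [min_eq_right h]; linarith
  rw [abs_le]
  constructor
  · rcases le_total 0 G with h | h
    · have : 0 ≤ m * G := by positivity
      linarith
    · have : G ≤ m * G := by nlinarith
      linarith
  -- The new scaling factor is at most (1 + D) times the old one and D ≤ 1/9, so the total is at
  -- most (10/9)(2μ) + ε²/36 = 7ε²/12.
  · have hmb : min y 1 * b ≤ 2 * μ := by
      have h3 : u * (1 - t) ≤ 1 + D := by
        calc u * (1 - t) ≤ 1 * (1 - t) := mul_le_mul_of_nonneg_right hu1 (by linarith)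
          _ ≤ 1 + D := by linarith
      have h4 := mul_le_mul_of_nonneg_left h3 hμ0.le
      linarith
    have h3 : m * b ≤ (1 + D) * (2 * μ) := by
      rcases le_total 0 b with h | h
      · calc m * b ≤ (1 + D) * min y 1 * b := mul_le_mul_of_nonneg_right hm'2 h
          _ = (1 + D) * (min y 1 * b) := by ring
          _ ≤ _ := mul_le_mul_of_nonneg_left hmb (by positivity)
      · exact (mul_nonpos_of_nonneg_of_nonpos hm'0.le h).trans (by positivity)
    have h4 := mul_le_mul_of_nonneg_left hG2 hm'0.le
    have h5 : m * (ε ^ 2 / 36) ≤ 1 * (ε ^ 2 / 36) :=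
      mul_le_mul_of_nonneg_right hm'1 (by positivity)
    have h6 : D * (2 * μ) ≤ 1 / 9 * (2 * μ) :=
      mul_le_mul_of_nonneg_right (by linarith) (by positivity)
    linarith

/-- A short approximate Newton step leads to a point that is approximately first-order optimal. -/
lemma callsOracle_of_short_newton (hP : P.Valid) (hU : LipschitzHessianOn f U LH) (hL : 0 < LH)
    (hx : ∀ i, 0 < x i) {v : Vec n} (hseg : segment ℝ x (x + Xbar x v) ⊆ U)
    (hv : ‖v‖ ≤ cd LH P.ζr P.ζbar * P.εH)
    (hr : supNorm (damped (scaledHess (barrier f P.μ) x) P.εH v + scaledGrad (barrier f P.μ) x) ≤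
      P.cμ) : CallsOracle P f (x + Xbar x v) := by
  have hf := hU.contDiffAt (hseg (left_mem_segment ℝ _ _))
  have hε := hP.εH_pos
  have hε1 := hP.εH_lt_one
  have hζ0 := hP.ζbar_pos
  have hζ1 := hP.ζbar_lt
  have hζr := hP.ζr_pos
  have hμ := hP.μ_eq
  have hD0 := norm_nonneg v
  have hD1 : ‖v‖ ≤ (1 - P.ζbar) / 9 * P.εH :=
    hv.trans (mul_le_mul_of_nonneg_right (min_le_left _ _) hε.le)
  have hD2 : LH * ‖v‖ ≤ P.εH / 2 := by
    have h1 : ‖v‖ ≤ 1 / (2 * (LH + 9 / 2 + P.ζr)) * P.εH := hv.trans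
      (mul_le_mul_of_nonneg_right ((min_le_right _ _).trans (min_le_right _ _)) hε.le)
    rw [div_mul_eq_mul_div, le_div_iff₀ (by positivity)] at h1
    nlinarith
  have hD3 : ‖v‖ ≤ P.εH / 9 := by nlinarith
  -- The Taylor error is the product of L_H‖v‖/2 ≤ ε_H/4 and ‖v‖ ≤ ε_H/9.
  have hδ : LH / 2 * ‖v‖ ^ 2 ≤ P.εH ^ 2 / 36 := by nlinarith
  have hμD : (P.μ + 2 * P.εH) * ‖v‖ ≤ (1 - P.ζbar) * P.μ := by
    have h1 : P.μ + 2 * P.εH ≤ 9 / 4 * P.εH := by rw [hμ]; nlinarith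
    have h2 := mul_le_mul_of_nonneg_right h1 hD0
    have h3 : P.εH * ‖v‖ ≤ (1 - P.ζbar) * P.εH ^ 2 / 9 := by nlinarith
    rw [hμ] at h2 ⊢
    linarith
  have key : ∀ i, -P.εg < gradient f (x + Xbar x v) i ∧
      |min ((x + Xbar x v) i) 1 * gradient f (x + Xbar x v) i| ≤ P.εg := by
    intro i
    have hxp : (x + Xbar x v) i = x i * (1 + relVec x v i) := by
      simpa using add_smul_Xbar_apply hx v 1 i
    have hG := abs_le.1 ((abs_le_norm _ i).trans (gradient_taylor hU hseg))
    have hG' := pow_le_pow_left₀ (norm_nonneg _) (norm_Xbar_le hx v) 2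
    have hri := abs_le.1 ((abs_le_supNorm _ i).trans hr)
    simp only [PiLp.sub_apply, PiLp.add_apply, damped_apply, PiLp.smul_apply, smul_eq_mul,
      scaledHess_barrier_apply hf hx, scaledGrad_barrier_apply hf hx] at hG hri
    have hGd : LH / 2 * ‖Xbar x v‖ ^ 2 ≤ P.εH ^ 2 / 36 :=
      (mul_le_mul_of_nonneg_left hG' (by positivity)).trans hδ
    rw [Params.cμ] at hri
    rw [hxp, ← hP.εH_sq]
    refine short_newton_coordinate (b := gradient f x i + hess f x (Xbar x v) i) (w := v i)
      hε hζ0 hζ1 hμ hD3 hε1 hμD (hx i)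
      ((abs_relVec_le hx v i).trans (abs_le_norm v i)) (abs_le_norm v i) rfl ?_ ?_ ?_ ?_
    · linarith [hri.1]
    · linarith [hri.2]
    · linarith [hG.1]
    · linarith [hG.2]
  rintro (⟨i, hi⟩ | h)
  · linarith [(key i).1]
  · refine absurd h (not_lt.2 ((supNorm_le_iff hP.εg_pos.le _).2 fun i => ?_))
    rw [scaledGrad, Xbar_apply]
    exact (key i).2

lemma move_of_newton (hP : P.Valid) (hU : LipschitzHessianOn f U LH) (hL : 0 < LH)
    (hx : ∀ i, 0 < x i) (hseg : segment ℝ x (x + Xbar x d) ⊆ U) {v : Vec n}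
    (hno : ¬ CallsOracle P f x)
    (hcurv : P.εH * ‖v‖ ^ 2 ≤ ⟪v, damped (scaledHess (barrier f P.μ) x) P.εH v⟫_ℝ)
    (hg : ⟪scaledGrad (barrier f P.μ) x, v⟫_ℝ =
      -⟪v, damped (scaledHess (barrier f P.μ) x) P.εH v⟫_ℝ)
    (hr : supNorm (damped (scaledHess (barrier f P.μ) x) P.εH v + scaledGrad (barrier f P.μ) x) ≤
      P.cμ)
    (hd : SOLStep P x v d) {s' : State n} (h : LineSearch P f x d s') :
    ∃ x' s, s' = (.running, x') ∧ GoodMove P f x x' s ∧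
      (call LH P.θ P.ζr P.ζbar P.β P.η * P.εH / 4 ≤ s ∨ CallsOracle P f x') := by
  have hε := hP.εH_pos
  have hΛ := cubicCoeff_pos hL hP.η_pos hP.β_lt
  have hc := call_pos (θ := P.θ) hL hP.η_pos hP.β_lt hP.θ_pos hP.ζr_pos hP.ζbar_lt
  have hcd : 0 < cd LH P.ζr P.ζbar := hc.trans_le call_le_cd
  rw [SOLStep] at hd
  -- A zero solution would be a short Newton step that stays at x, which would therefore pass the
  -- first-order tests.
  have hv : v ≠ 0 := by
    rintro rfl
    rw [smul_zero] at hd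
    rw [hd] at hseg
    have := callsOracle_of_short_newton hP hU hL hx hseg (by rw [norm_zero]; positivity) hr
    rw [map_zero, add_zero] at this
    exact hno this
  obtain ⟨hrel, hd0, hgd, hHd, hvd⟩ := newton_scaling hx hP.β_pos hε hv hcurv hg hd
  have hdn := norm_pos_iff.2 hd0
  obtain ⟨j, hj, hmin, rfl⟩ := lineSearch_result h (by
    obtain ⟨j, hj⟩ := exists_pow_mul_lt hP (K := cubicCoeff LH P.β P.η * ‖d‖) (c := 6 * P.εH)
      (by positivity) (by positivity)
    refine ⟨j, accepts_of_newton hP hU hL hx hseg hrel hd0 hgd hHd ?_⟩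
    have h1 : (P.θ ^ j) ^ 2 ≤ P.θ ^ j := by
      rw [sq]
      exact mul_le_of_le_one_left (pow_pos hP.θ_pos j).le (pow_le_one₀ hP.θ_pos.le hP.θ_lt.le)
    calc (P.θ ^ j) ^ 2 * cubicCoeff LH P.β P.η * ‖d‖
        ≤ P.θ ^ j * cubicCoeff LH P.β P.η * ‖d‖ := by gcongr
      _ ≤ 6 * P.εH := by rw [mul_assoc]; exact hj.le)
  refine ⟨_, _, rfl, goodMove_of_accepts hP hx hrel hj, ?_⟩
  cases j with
  | zero =>
    simp only [pow_zero, one_mul, one_smul]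
    rcases le_or_gt (call LH P.θ P.ζr P.ζbar P.β P.η * P.εH / 4) ‖d‖ with h1 | h1
    · exact Or.inl h1
    · right
      -- Only an unscaled direction can be short: a scaled one has length at least β ≥ ε_H.
      rcases hvd with rfl | hvd
      · refine callsOracle_of_short_newton hP hU hL hx hseg ?_ hr
        have := mul_le_mul_of_nonneg_right (call_le_cd (LH := LH) (θ := P.θ) (ζr := P.ζr)
          (ζbar := P.ζbar) (β := P.β) (η := P.η)) hε.le
        have : 0 < call LH P.θ P.ζr P.ζbar P.β P.η * P.εH := by positivity
        linarith
      · have h2 : P.εH ≤ P.β := hP.β_ge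
        have h3 := mul_le_mul_of_nonneg_right (call_le_one (LH := LH) (θ := P.θ) (ζr := P.ζr)
          (ζbar := P.ζbar) (β := P.β) (η := P.η)) hε.le
        linarith
  | succ j =>
    left
    have h1 : 6 * P.εH < cubicCoeff LH P.β P.η * ‖d‖ := by
      by_contra! h'
      exact hmin 0 (by omega) (accepts_of_newton hP hU hL hx hseg hrel hd0 hgd hHd (by simpa))
    have h2 : 6 * P.εH < (P.θ ^ j) ^ 2 * cubicCoeff LH P.β P.η * ‖d‖ := by
      by_contra! h'
      exact hmin j (by omega) (accepts_of_newton hP hU hL hx hseg hrel hd0 hgd hHd h')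
    -- Both the unit step and the previous trial were rejected. Multiplying the two inequalities and
    -- taking roots turns the square of the step length into its first power.
    have h3 : 6 * P.εH ≤ P.θ ^ j * ‖d‖ * cubicCoeff LH P.β P.η := by
      have h5 : 0 < P.θ ^ j := pow_pos hP.θ_pos j
      refine abs_le_of_sq_le_sq' ?_ (by positivity) |>.2
      have := mul_le_mul h2.le h1.le (by positivity) (by positivity)
      nlinarith
    have h4 := call_le_sol (θ := P.θ) (ζr := P.ζr) (ζbar := P.ζbar) hL hP.η_pos hP.β_lt
    rw [le_div_iff₀ hΛ] at h4
    refine le_of_mul_le_mul_right ?_ hΛ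
    have h6 : call LH P.θ P.ζr P.ζbar P.β P.η * P.εH * cubicCoeff LH P.β P.η ≤
        6 * P.θ ^ 2 * P.εH := by nlinarith
    have h7 : 6 * P.θ ^ 2 * P.εH ≤ P.θ * (6 * P.εH) := by
      nlinarith [hP.θ_lt, hP.θ_pos, mul_pos hP.θ_pos hε]
    have h8 := mul_le_mul_of_nonneg_left h3 hP.θ_pos.le
    have h9 : 0 < call LH P.θ P.ζr P.ζbar P.β P.η * P.εH * cubicCoeff LH P.β P.η := by positivity
    rw [pow_succ]
    linarith

end LineSearch

/-! ### Outcomes of one iteration -/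

section Iteration

variable {n : ℕ} {P : Params} {f : Vec n → ℝ} {x : Vec n} {U : Set (Vec n)} {LH : ℝ}

/-- At a stationary point of the barrier function ∇f = μ x⁻¹ is positive and its scaled entries are
at most μ ≤ ε_g, so the first-order tests pass. Hence capped CG always receives a nonzero g. -/
lemma scaledGrad_barrier_ne_zero (hP : P.Valid) (hf : ContDiffAt ℝ 2 f x) (hx : ∀ i, 0 < x i)
    (hno : ¬ CallsOracle P f x) : scaledGrad (barrier f P.μ) x ≠ 0 := by
  intro h0
  have hμ := hP.μ_pos
  have hμε : P.μ ≤ P.εg := by rw [Params.μ]; linarith [hP.εg_pos]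
  have hgr : ∀ i, gradient f x i = P.μ * (x i)⁻¹ := by
    intro i
    have h1 : scaledGrad (barrier f P.μ) x i = 0 := by rw [h0]; rfl
    rw [scaledGrad_barrier_apply hf hx] at h1
    have h2 : min (x i) 1 ≠ 0 := (lt_min (hx i) one_pos).ne'
    linarith [(mul_eq_zero.1 h1).resolve_left h2]
  refine hno ?_
  rintro (⟨i, hi⟩ | h)
  · rw [hgr] at hi
    have := hx i
    have : 0 < P.μ * (x i)⁻¹ := by positivity
    linarith [hP.εg_pos]
  · refine absurd h (not_lt.2 ((supNorm_le_iff hP.εg_pos.le _).2 fun i => ?_))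
    have h2 : 0 < min (x i) 1 := lt_min (hx i) one_pos
    have h3 : min (x i) 1 * (x i)⁻¹ ≤ 1 := by
      rw [mul_inv_le_iff₀ (hx i), one_mul]; exact min_le_left _ _
    have h4 := hx i
    rw [scaledGrad, Xbar_apply, hgr, abs_of_nonneg (by positivity)]
    nlinarith

lemma callsOracle_epsFirstOrder (hx : ∀ i, 0 < x i) (h : CallsOracle P f x) :
    EpsFirstOrder f P.εg x := by
  simp only [CallsOracle, not_or, not_exists, not_le, not_lt] at h
  exact ⟨hx, fun i => (h.1 i).le, h.2⟩

/-- The possible outcomes of an iteration. -/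
lemma iteration_outcome (hP : P.Valid) (hU : LipschitzHessianOn f U LH) (hL : 0 < LH)
    (hx : ∀ i, 0 < x i) (hxU : x ∈ U) {o : Option (Vec n)} {d : Vec n} {s' : State n}
    (hseg : SearchDir P f x o d → segment ℝ x (x + Xbar x d) ⊆ U)
    (ho : CallsOracle P f x → ∀ v, o = some v →
      ‖v‖ = 1 ∧ ⟪v, scaledHess f x v⟫_ℝ ≤ -P.εH / 2)
    (h : Iteration P f o d (.running, x) s') :
    (CallsOracle P f x ∧ o = none ∧ s' = (.stopped, x)) ∨
    ∃ x' s, s' = (.running, x') ∧ GoodMove P f x x' s ∧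
      (call LH P.θ P.ζr P.ζbar P.β P.η * P.εH / 4 ≤ s ∨
        ¬ CallsOracle P f x ∧ CallsOracle P f x') := by
  have hf := hU.contDiffAt hxU
  have hε := hP.εH_pos
  have hε1 := hP.εH_lt_one
  have hβ : P.εH ≤ P.β := hP.β_ge
  have hH := scaledHess_barrier_symm (μ := P.μ) hf hx
  rcases h with ⟨h, -⟩ | ⟨-, h1, h2, h3⟩ | ⟨-, h1, h2, -⟩ | ⟨-, hS, hLS⟩
  · exact absurd rfl h
  · exact Or.inl ⟨h1, h2, h3⟩
  · refine absurd ?_ h2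
    exact cappedCG_exists hH hε hP.Mμ_nonneg hP.ζr_pos hP.cμ_pos
      (scaledGrad_barrier_ne_zero hP hf hx h1)
  · right
    have hsg := hseg hS
    rcases hS with ⟨hno, v, ⟨hv, σ, hσ, hd⟩ | ⟨hv, hd⟩⟩ | ⟨hc, v, hv, σ, hσ, hd⟩
    · have hw := cappedCG_nc hv
      rw [WeakCurv, inner_damped] at hw
      have hv0 : v ≠ 0 := by rintro rfl; simp at hw
      obtain ⟨h1, h2, h3, h4⟩ := negative_curvature_scaling hx hP.β_pos hβ hε hv0
        (by linarith) hσ hd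
      obtain ⟨x', s, h5, h6, h7⟩ := move_of_negative_curvature hP hU hL hx hsg h1 h2 h3
        (by linarith) hLS
      exact ⟨x', s, h5, h6, Or.inl h7⟩
    · obtain ⟨h1, h2, h3⟩ := cappedCG_sol hH hε hP.Mμ_nonneg hP.ζr_pos hP.cμ_pos
        (scaledGrad_barrier_ne_zero hP hf hx hno) hv
      obtain ⟨x', s, h5, h6, h7⟩ := move_of_newton hP hU hL hx hsg hno h1 h2 h3 hd hLS
      exact ⟨x', s, h5, h6, h7.imp_right fun h => ⟨hno, h⟩⟩
    · obtain ⟨hv1, hv2⟩ := ho hc v hv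
      have hv0 : v ≠ 0 := by rintro rfl; simp at hv1
      rw [real_inner_comm] at hσ
      -- The barrier adds at most μ = ε_H²/4 ≤ ε_H/4 to a curvature of at most -ε_H/2. This loss
      -- explains the 4 in s₀.
      have hcurv : ⟪v, scaledHess (barrier f P.μ) x v⟫_ℝ ≤ -(P.εH / 4 * ‖v‖ ^ 2) := by
        rw [inner_scaledHess] at hv2
        rw [inner_scaledHess_barrier hf hx]
        have h1 := mul_le_mul_of_nonneg_left (sum_relVec_sq_le hx v) hP.μ_pos.le
        rw [hv1] at h1 ⊢
        have h2 : P.μ ≤ P.εH / 4 := by rw [hP.μ_eq]; nlinarith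
        linarith
      obtain ⟨h1, h2, h3, h4⟩ := negative_curvature_scaling (d := d) (q := P.εH / 4) hx hP.β_pos
        (by linarith) (by linarith) hv0 hcurv hσ (by rw [hv1]; simpa using hd)
      obtain ⟨x', s, h5, h6, h7⟩ := move_of_negative_curvature hP hU hL hx hsg h1 h2 h3 h4 hLS
      exact ⟨x', s, h5, h6, Or.inl h7⟩

end Iteration

/-! ### Counting iterations -/

section Complexity

variable {n : ℕ} {P : Params} {f : Vec n → ℝ} {LH : ℝ}

/-- The decrease of the log-barrier function in every sufficiently long step. -/
noncomputable def minDecrease (P : Params) (LH : ℝ) : ℝ :=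
  P.η / 6 * (call LH P.θ P.ζr P.ζbar P.β P.η * P.εH / 4) ^ 3

/-- Progress of a run within `k` iterations, up to one short step at the end. -/
def Progress (P : Params) (f : Vec n → ℝ) (LH : ℝ) (x0 : Vec n) (k : ℕ) (x : Vec n) : Prop :=
  let s₀ := call LH P.θ P.ζr P.ζbar P.β P.η * P.εH / 4
  let a := barrier f P.μ x0 - barrier f P.μ x
  (k * minDecrease P LH ≤ 2 * a ∧ ‖x - x0‖ ≤ 2 * (6 / (P.η * s₀ ^ 2)) * a) ∨
  (CallsOracle P f x ∧ (k - 1) * minDecrease P LH < 2 * a ∧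
    ‖x - x0‖ ≤ 2 * (6 / (P.η * s₀ ^ 2)) * a + s₀)

/-- A long move earns more than D = η s₀³/6 and counts with weight 2, which pays also for a short
move before it. The second alternative holds the unpaid short move; as the oracle is called there,
the next move is long and settles it. -/
lemma Progress.step (hP : P.Valid) (hL : 0 < LH) {x0 x x' : Vec n} {k : ℕ}
    (h : Progress P f LH x0 k x) {s : ℝ} (hm : GoodMove P f x x' s)
    (hs : call LH P.θ P.ζr P.ζbar P.β P.η * P.εH / 4 ≤ s ∨
      ¬ CallsOracle P f x ∧ CallsOracle P f x') : Progress P f LH x0 (k + 1) x' := by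
  have hc := call_pos (θ := P.θ) hL hP.η_pos hP.β_lt hP.θ_pos hP.ζr_pos hP.ζbar_lt
  have hε := hP.εH_pos
  have hη := hP.η_pos
  have hdec := hm.decrease
  have hs0 := hm.nonneg
  have htri : ‖x' - x0‖ ≤ s + ‖x - x0‖ := by
    have := norm_add_le (x' - x) (x - x0)
    rw [sub_add_sub_cancel] at this
    linarith [hm.dist]
  simp only [Progress, minDecrease] at h ⊢
  set s₀ := call LH P.θ P.ζr P.ζbar P.β P.η * P.εH / 4
  have hs₀ : 0 < s₀ := by positivity
  obtain ⟨c, hcdef⟩ : ∃ c, c = 6 / (P.η * s₀ ^ 2) := ⟨_, rfl⟩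
  have hcpos : 0 < c := by rw [hcdef]; positivity
  -- The factor c converts decrease into length: exactly at s₀, and with room to spare for longer
  -- moves.
  have hcD : c * (P.η / 6 * s₀ ^ 3) = s₀ := by rw [hcdef]; field_simp
  rw [← hcdef] at h ⊢
  push_cast
  have hlong : s₀ ≤ s → P.η / 6 * s₀ ^ 3 < barrier f P.μ x - barrier f P.μ x' ∧
      s ≤ c * (barrier f P.μ x - barrier f P.μ x') := by
    intro h1
    have h2 : s₀ ^ 3 ≤ s ^ 3 := pow_le_pow_left₀ hs₀.le h1 3
    have h3 : P.η / 6 * s₀ ^ 3 ≤ P.η / 6 * s ^ 3 := by gcongr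
    refine ⟨by linarith, ?_⟩
    have h4 : s ≤ c * (P.η / 6 * s ^ 3) := by
      have h6 : c * (P.η / 6 * s ^ 3) = s * (s ^ 2 / s₀ ^ 2) := by rw [hcdef]; field_simp
      rw [h6]
      refine le_mul_of_one_le_right hs0 ?_
      rw [one_le_div (by positivity)]
      exact pow_le_pow_left₀ hs₀.le h1 2
    exact h4.trans (mul_le_mul_of_nonneg_left hdec.le hcpos.le)
  have hδ : 0 < barrier f P.μ x - barrier f P.μ x' :=
    lt_of_le_of_lt (by positivity) hdec
  generalize P.η / 6 * s₀ ^ 3 = D at *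
  have hcδ := mul_pos hcpos hδ
  rcases h with ⟨h1, h2⟩ | ⟨h0, h1, h2⟩
  · rcases le_or_gt s₀ s with h3 | h3
    · obtain ⟨h4, h5⟩ := hlong h3
      left
      constructor <;> linarith
    · right
      refine ⟨(hs.resolve_left (not_le.2 h3)).2, ?_, ?_⟩ <;> linarith
  · have h3 : s₀ ≤ s := hs.resolve_right fun h' => h'.1 h0
    obtain ⟨h4, h5⟩ := hlong h3
    left
    have h6 := mul_le_mul_of_nonneg_left h4.le hcpos.le
    constructor <;> linarith

lemma sum_sub_le (x y : Vec n) : ∑ i, (x i - y i) ≤ √(n : ℝ) * ‖x - y‖ := by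
  have h1 := sq_sum_le_card_mul_sum_sq (s := Finset.univ) (f := fun i => x i - y i)
  have h2 : ‖x - y‖ ^ 2 = ∑ i, (x i - y i) ^ 2 := by
    rw [EuclideanSpace.norm_sq_eq]; simp
  refine abs_le_of_sq_le_sq' ?_ (by positivity) |>.2
  rw [mul_pow, Real.sq_sqrt (Nat.cast_nonneg n), h2]
  simpa using h1

lemma omega2_pos (hn : 0 < n) (hP : P.Valid) (hL : 0 < LH) (x0 : Vec n) :
    0 < omega2 P LH x0 := by
  have hc := call_pos (θ := P.θ) hL hP.η_pos hP.β_lt hP.θ_pos hP.ζr_pos hP.ζbar_lt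
  have hη := hP.η_pos
  have hn' : (0 : ℝ) < √n := Real.sqrt_pos.2 (by exact_mod_cast hn)
  exact lt_max_of_lt_left (by positivity)

/-- The log-barrier function is bounded below in terms of the distance from the start. -/
lemma barrier_gap_le (hn : 0 < n) (hP : P.Valid) (hL : 0 < LH) {flow : ℝ} {x0 x : Vec n}
    (hx : ∀ i, 0 < x i) (hflow : flow ≤ f x) :
    barrier f P.μ x0 - barrier f P.μ x ≤
      (f x0 - flow + P.μ * n * (Real.log (omega2 P LH x0) - ⨅ i, Real.log (x0 i))) +
        P.η * call LH P.θ P.ζr P.ζbar P.β P.η ^ 2 * P.εH ^ 2 / 384 * ‖x - x0‖ := by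
  have hc := call_pos (θ := P.θ) hL hP.η_pos hP.β_lt hP.θ_pos hP.ζr_pos hP.ζbar_lt
  have hη := hP.η_pos
  have hω := omega2_pos hn hP hL x0
  have hn' : (0 : ℝ) < √n := Real.sqrt_pos.2 (by exact_mod_cast hn)
  have h1 : ∀ i ∈ Finset.univ, ⨅ i, Real.log (x0 i) ≤ Real.log (x0 i) := fun i _ =>
    ciInf_le (Set.finite_range _).bddBelow i
  have h2 := Finset.sum_le_sum h1
  rw [Finset.sum_const, Finset.card_univ, Fintype.card_fin, nsmul_eq_mul] at h2
  have h3 : ∀ i ∈ Finset.univ, Real.log (x i) ≤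
      Real.log (omega2 P LH x0) + (x i - x0 i) / omega2 P LH x0 := by
    intro i _
    have h4 := Real.log_le_sub_one_of_pos (div_pos (hx i) hω)
    rw [Real.log_div (hx i).ne' hω.ne'] at h4
    -- Because ω₂ dominates every x⁰_i, the tangent bound x_i/ω₂ - 1 is at most (x_i - x⁰_i)/ω₂.
    have h5 : x0 i ≤ omega2 P LH x0 :=
      (le_abs_self _).trans ((abs_le_supNorm x0 i).trans (le_max_right _ _))
    have h6 : x0 i / omega2 P LH x0 ≤ 1 := (div_le_one hω).2 h5
    rw [sub_div]
    linarith
  have h4 := Finset.sum_le_sum h3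
  rw [Finset.sum_add_distrib, Finset.sum_const, Finset.card_univ, Fintype.card_fin, nsmul_eq_mul,
    ← Finset.sum_div] at h4
  have h5 : P.μ * ((∑ i, (x i - x0 i)) / omega2 P LH x0) ≤
      P.η * call LH P.θ P.ζr P.ζbar P.β P.η ^ 2 * P.εH ^ 2 / 384 * ‖x - x0‖ := by
    -- The first entry of ω₂ absorbs the √n of the Cauchy–Schwarz estimate; 384 = 4 · 96, the 4
    -- coming from μ.
    have h6 : 96 * √(n : ℝ) ≤
        omega2 P LH x0 * (P.η * call LH P.θ P.ζr P.ζbar P.β P.η ^ 2) :=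
      (div_le_iff₀ (by positivity)).1 (le_max_left _ _)
    rw [hP.μ_eq, ← mul_div_assoc, div_le_iff₀ hω]
    have h7 := mul_le_mul_of_nonneg_left (sum_sub_le x x0) (by positivity : 0 ≤ P.εH ^ 2 / 4)
    have h8 := mul_le_mul_of_nonneg_right h6 (by positivity : 0 ≤ P.εH ^ 2 / 384 * ‖x - x0‖)
    linarith
  have h6 := mul_le_mul_of_nonneg_left h2 hP.μ_pos.le
  have h7 := mul_le_mul_of_nonneg_left h4 hP.μ_pos.le
  simp only [barrier]
  linarith

lemma rpow_neg_mul_εH_cube (hP : P.Valid) : P.εg ^ (-(3 / 2) : ℝ) * P.εH ^ 3 = 1 := by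
  rw [Params.εH, Real.sqrt_eq_rpow, ← Real.rpow_natCast, ← Real.rpow_mul hP.εg_pos.le,
    ← Real.rpow_add hP.εg_pos]
  norm_num

/-- No run can make as many steps as the iteration bound. -/
lemma not_progress_K2 (hn : 0 < n) (hP : P.Valid) (hL : 0 < LH) {flow : ℝ} {x0 x : Vec n}
    (hx : ∀ i, 0 < x i) (hflow : flow ≤ f x) :
    ¬ Progress P f LH x0 (K2 P LH x0 (f x0 - flow)) x := by
  intro h
  have hc := call_pos (θ := P.θ) hL hP.η_pos hP.β_lt hP.θ_pos hP.ζr_pos hP.ζbar_lt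
  have hε := hP.εH_pos
  have hη := hP.η_pos
  have hgap := barrier_gap_le hn hP hL (x0 := x0) hx hflow
  have hD : 0 < minDecrease P LH := by rw [minDecrease]; positivity
  -- The summand 2 in K₂ becomes 2D: one D for the unpaid short move in the count, one for its
  -- length in the distance bound.
  have hK : 4 * (f x0 - flow + P.μ * n * (Real.log (omega2 P LH x0) - ⨅ i, Real.log (x0 i))) +
      2 * minDecrease P LH ≤ K2 P LH x0 (f x0 - flow) * minDecrease P LH := by
    rw [K2]
    push_cast
    rw [add_mul]
    refine add_le_add ?_ le_rfl
    refine le_trans (le_of_eq ?_) (mul_le_mul_of_nonneg_right (Nat.le_ceil _) hD.le)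
    generalize f x0 - flow + P.μ * n * (Real.log (omega2 P LH x0) - ⨅ i, Real.log (x0 i)) = B
    have e : minDecrease P LH =
        P.η * call LH P.θ P.ζr P.ζbar P.β P.η ^ 3 / 384 * P.εH ^ 3 := by
      rw [minDecrease]; ring
    calc 4 * B = 4 * B * (P.εg ^ (-(3 / 2) : ℝ) * P.εH ^ 3) := by
          rw [rpow_neg_mul_εH_cube hP, mul_one]
      _ = _ := by rw [e]; field_simp; ring
  generalize f x0 - flow + P.μ * n * (Real.log (omega2 P LH x0) - ⨅ i, Real.log (x0 i)) = B at *
  generalize (K2 P LH x0 (f x0 - flow)) = K at *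
  simp only [Progress] at h
  obtain ⟨q, hq⟩ : ∃ q, q = P.η * call LH P.θ P.ζr P.ζbar P.β P.η ^ 2 * P.εH ^ 2 / 384 := ⟨_, rfl⟩
  have hq0 : 0 < q := by rw [hq]; positivity
  rw [← hq] at hgap
  -- With this value, q times the distance is at most half the decrease, plus D/4 for an unpaid
  -- short move.
  have e1 : 6 / (P.η * (call LH P.θ P.ζr P.ζbar P.β P.η * P.εH / 4) ^ 2) = 1 / (4 * q) := by
    rw [hq]; field_simp; norm_num
  have e2 : q * (call LH P.θ P.ζr P.ζbar P.β P.η * P.εH / 4) = minDecrease P LH / 4 := by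
    rw [hq, minDecrease]; ring
  rw [e1] at h
  have e3 : ∀ a : ℝ, q * (2 * (1 / (4 * q)) * a) = a / 2 := fun a => by field_simp; ring
  rcases h with ⟨h1, h2⟩ | ⟨-, h1, h2⟩
  · have h3 := mul_le_mul_of_nonneg_left h2 hq0.le
    rw [e3] at h3
    linarith
  · have h3 := mul_le_mul_of_nonneg_left h2 hq0.le
    rw [mul_add, e3, e2] at h3
    linarith

/-- Along a run, the algorithm stops at a point that is approximately first-order optimal, or
it makes progress. -/
lemma run_progress {U : Set (Vec n)} (hP : P.Valid) (hU : LipschitzHessianOn f U LH) (hL : 0 < LH)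
    {x0 : Vec n} (hx0 : ∀ i, 0 < x0 i) {S : ℕ → State n} {d : ℕ → Vec n}
    {o : ℕ → Option (Vec n)} (hrun : IsRun P f x0 S d o) (hpath : ContainsPath P f U S d o)
    (hsound : OracleSound P f S o) (k : ℕ) : (∀ i, 0 < (S k).2 i) ∧
      (((S k).1 = .stopped ∧ CallsOracle P f (S k).2) ∨
        ((S k).1 = .running ∧ Progress P f LH x0 k (S k).2)) := by
  induction k with
  | zero =>
    rw [hrun.init]
    refine ⟨hx0, Or.inr ⟨rfl, Or.inl ?_⟩⟩
    simp
  | succ k ih =>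
    obtain ⟨hpos, ⟨h1, h2⟩ | ⟨h1, h2⟩⟩ := ih
    · have hne : (S k).1 ≠ .running := by rw [h1]; exact Status.noConfusion
      have hS : S (k + 1) = S k := by
        rcases hrun.step k with h | h | h | h
        · exact h.2
        · exact absurd h.1 hne
        · exact absurd h.1 hne
        · exact absurd h.1 hne
      rw [hS]
      exact ⟨hpos, Or.inl ⟨h1, h2⟩⟩
    · have hSk : S k = (.running, (S k).2) := Prod.ext h1 rfl
      have hit := hrun.step k
      rw [hSk] at hit
      rcases iteration_outcome hP hU hL hpos (hpath k).1 ((hpath k).2 h1)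
        (fun hc v hv => hsound k v h1 hc hv) hit with ⟨h3, -, h4⟩ | ⟨x', s, h3, h4, h5⟩
      · rw [h4]
        exact ⟨hpos, Or.inl ⟨rfl, h3⟩⟩
      · rw [h3]
        exact ⟨h4.pos, Or.inr ⟨rfl, h2.step hP hL h4 h5⟩⟩

theorem run_terminates {U : Set (Vec n)} (hn : 0 < n) (hP : P.Valid)
    (hU : LipschitzHessianOn f U LH) (hL : 0 < LH) {flow : ℝ}
    (hflow : ∀ x : Vec n, (∀ i, 0 < x i) → flow ≤ f x)
    {x0 : Vec n} (hx0 : ∀ i, 0 < x0 i) {S : ℕ → State n} {d : ℕ → Vec n}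
    {o : ℕ → Option (Vec n)} (hrun : IsRun P f x0 S d o) (hpath : ContainsPath P f U S d o)
    (hsound : OracleSound P f S o) :
    (S (K2 P LH x0 (f x0 - flow))).1 = .stopped ∧
      EpsFirstOrder f P.εg (S (K2 P LH x0 (f x0 - flow))).2 := by
  obtain ⟨hpos, ⟨h1, h2⟩ | ⟨-, h2⟩⟩ :=
    run_progress hP hU hL hx0 hrun hpath hsound (K2 P LH x0 (f x0 - flow))
  · exact ⟨h1, callsOracle_epsFirstOrder hpos h2⟩
  · exact absurd h2 (not_progress_K2 hn hP hL hpos (hflow _ hpos))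

end Complexity

/-! ### Measurability of the events -/

section Measurability

variable {n : ℕ} {f : Vec n → ℝ} {U : Set (Vec n)} {LH : ℝ}

lemma LipschitzHessianOn.continuousOn_hess (hU : LipschitzHessianOn f U LH) :
    ContinuousOn (hess f) U := by
  have h : LipschitzOnWith (Real.toNNReal LH) (hess f) U := by
    refine LipschitzOnWith.of_dist_le_mul fun x hx y hy => ?_
    rw [dist_eq_norm, dist_eq_norm]
    exact (hU.lipschitz x hx y hy).trans
      (mul_le_mul_of_nonneg_right (Real.le_coe_toNNReal LH) (norm_nonneg _))
  exact h.continuousOn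

lemma LipschitzHessianOn.continuousOn_gradient (hU : LipschitzHessianOn f U LH) :
    ContinuousOn (gradient f) U := fun _ hx =>
  (hasFDerivAt_gradient (hU.contDiffAt hx)).continuousAt.continuousWithinAt

lemma continuous_Xbar : Continuous fun p : Vec n × Vec n => Xbar p.1 p.2 := by
  have : (fun p : Vec n × Vec n => Xbar p.1 p.2) =
      fun p => WithLp.toLp 2 fun i => min (p.1 i) 1 * p.2 i := by
    funext p; ext i; exact Xbar_apply _ _ _
  rw [this]
  fun_prop

/-- Failure of the second-order condition has a witness w, and for fixed w it is an open condition
on U. -/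
lemma isOpen_not_epsSecondOrder (hU : LipschitzHessianOn f U LH) (ε : ℝ) :
    IsOpen {x | x ∈ U ∧ ¬ EpsSecondOrder f ε x} := by
  have h : {x | x ∈ U ∧ ¬ EpsSecondOrder f ε x} =
      ⋃ w : Vec n, U ∩ (fun x => ⟪w, scaledHess f x w⟫_ℝ) ⁻¹' Set.Iio (-ε * ‖w‖ ^ 2) := by
    ext x
    simp [EpsSecondOrder]
  rw [h]
  refine isOpen_iUnion fun w => ContinuousOn.isOpen_inter_preimage ?_ hU.isOpen isOpen_Iio
  simp only [inner_scaledHess]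
  have h1 : ContinuousOn (fun x : Vec n => Xbar x w) U :=
    (continuous_Xbar.comp (by fun_prop : Continuous fun x : Vec n => (x, w))).continuousOn
  exact ContinuousOn.inner (𝕜 := ℝ) h1 (hU.continuousOn_hess.clm_apply h1)

lemma measurableSet_callsOracle (hU : LipschitzHessianOn f U LH) (P : Params) :
    MeasurableSet {x | x ∈ U ∧ CallsOracle P f x} := by
  have hg := hU.continuousOn_gradient
  have h : {x | x ∈ U ∧ CallsOracle P f x} =
      (U ∩ ⋂ i, U ∩ (fun x => gradient f x i) ⁻¹' Set.Ioi (-P.εg)) \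
        (U ∩ (fun x => supNorm (scaledGrad f x)) ⁻¹' Set.Ioi P.εg) := by
    ext x
    simp only [CallsOracle, Set.mem_ofPred_eq, not_or, not_exists, not_le, not_lt, Set.mem_sdiff,
      Set.mem_inter_iff, Set.mem_iInter, Set.mem_preimage, Set.mem_Ioi]
    constructor
    · rintro ⟨h1, h2, h3⟩
      exact ⟨⟨h1, fun i => ⟨h1, h2 i⟩⟩, fun h => not_lt.2 h3 h.2⟩
    · rintro ⟨⟨h1, h2⟩, h3⟩
      exact ⟨h1, fun i => (h2 i).2, not_lt.1 fun h => h3 ⟨h1, h⟩⟩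
  rw [h]
  refine (hU.isOpen.measurableSet.inter (MeasurableSet.iInter fun i => ?_)).diff ?_
  · refine (ContinuousOn.isOpen_inter_preimage ?_ hU.isOpen isOpen_Ioi).measurableSet
    exact (by fun_prop : Continuous fun v : Vec n => v i).comp_continuousOn hg
  · refine (ContinuousOn.isOpen_inter_preimage ?_ hU.isOpen isOpen_Ioi).measurableSet
    have h1 : Continuous (supNorm (n := n)) := continuous_norm.comp (PiLp.continuous_ofLp 2 _)
    refine h1.comp_continuousOn ?_
    have h3 := continuous_Xbar.comp_continuousOn
      ((continuousOn_id (s := U)).prodMk (hU.continuousOn_gradient (f := f)))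
    exact h3

end Measurability

/-! ### Probability of a wrong termination -/

section Probability

open MeasureTheory

variable {n : ℕ} {P : Params} {f : Vec n → ℝ} {U : Set (Vec n)} {LH δ : ℝ} {x0 : Vec n}
  {Ω : Type*} {m : MeasurableSpace Ω} {ℙ : Measure Ω} [IsProbabilityMeasure ℙ]
  {ℱ : Filtration ℕ m} {S : ℕ → Ω → State n} {d : ℕ → Ω → Vec n} {o : ℕ → Ω → Option (Vec n)}

/-- The event of a wrong termination within `k` iterations. -/
def wrongStop (P : Params) (f : Vec n → ℝ) (S : ℕ → Ω → State n) (k : ℕ) : Set Ω :=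
  {ω | (S k ω).1 = .stopped ∧ ¬ EpsSecondOrder f P.εH (S k ω).2}

/-- The event that the oracle is called in iteration `k` and can give a false certificate. -/
def criticalCall (P : Params) (f : Vec n → ℝ) (S : ℕ → Ω → State n) (k : ℕ) : Set Ω :=
  {ω | (S k ω).1 = .running ∧ CallsOracle P f (S k ω).2 ∧ ¬ EpsSecondOrder f P.εH (S k ω).2}

lemma measurableSet_wrongStop (hU : LipschitzHessianOn f U LH)
    (hS : ∀ k, Measurable[ℱ k] (S k)) (hSU : ∀ k ω, (S k ω).2 ∈ U) (k : ℕ) :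
    MeasurableSet[ℱ k] (wrongStop P f S k) := by
  have h : wrongStop P f S k =
      S k ⁻¹' ({Status.stopped} ×ˢ {x | x ∈ U ∧ ¬ EpsSecondOrder f P.εH x}) := by
    ext ω
    simp [wrongStop, hSU k ω]
  rw [h]
  exact hS k (MeasurableSet.prod MeasurableSpace.measurableSet_top
    (isOpen_not_epsSecondOrder hU _).measurableSet)

lemma measurableSet_criticalCall (hU : LipschitzHessianOn f U LH)
    (hS : ∀ k, Measurable[ℱ k] (S k)) (hSU : ∀ k ω, (S k ω).2 ∈ U) (k : ℕ) :
    MeasurableSet[ℱ k] (criticalCall P f S k) := by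
  have h : criticalCall P f S k = S k ⁻¹' ({Status.running} ×ˢ
      ({x | x ∈ U ∧ CallsOracle P f x} ∩ {x | x ∈ U ∧ ¬ EpsSecondOrder f P.εH x})) := by
    ext ω
    simp [criticalCall, hSU k ω]
  rw [h]
  exact hS k (MeasurableSet.prod MeasurableSpace.measurableSet_top
    ((measurableSet_callsOracle hU P).inter (isOpen_not_epsSecondOrder hU _).measurableSet))

/-- A running state becomes stopped only through a certificate, and the point does not change then.
-/
lemma wrongStop_succ_subset (hrun : ∀ ω, IsRun P f x0 (S · ω) (d · ω) (o · ω)) (k : ℕ) :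
    wrongStop P f S (k + 1) ⊆
      wrongStop P f S k ∪ (criticalCall P f S k ∩ {ω | o k ω = none}) := by
  rintro ω ⟨h1, h2⟩
  rcases (hrun ω).step k with ⟨-, h⟩ | ⟨hr, hc, ho, h⟩ | ⟨-, -, -, h⟩ | ⟨-, -, h⟩
  · rw [h] at h1 h2
    exact Or.inl ⟨h1, h2⟩
  · rw [h] at h2
    exact Or.inr ⟨⟨hr, hc, h2⟩, ho⟩
  · rw [h] at h1
    cases h1
  · rcases h with ⟨j, -, h⟩ | ⟨-, h⟩ <;>
    · rw [h] at h1
      cases h1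

lemma measureReal_wrongStop_le (hU : LipschitzHessianOn f U LH) (hδ0 : 0 ≤ δ) (hδ1 : δ < 1)
    (hS : ∀ k, Measurable[ℱ k] (S k)) (hrun : ∀ ω, IsRun P f x0 (S · ω) (d · ω) (o · ω))
    (hSU : ∀ k ω, (S k ω).2 ∈ U) (hfail : OracleFailureLe ℙ ℱ P f S o δ) (k : ℕ) :
    ℙ.real (wrongStop P f S k) ≤ 1 - (1 - δ) ^ k := by
  induction k with
  | zero =>
    have : wrongStop P f S 0 = ∅ := by
      ext ω
      have h := (hrun ω).init
      simp [wrongStop, h]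
    simp [this]
  | succ k ih =>
    have hW : MeasurableSet (wrongStop P f S k) :=
      ℱ.le k _ (measurableSet_wrongStop hU hS hSU k)
    have h1 : ℙ.real (wrongStop P f S (k + 1)) ≤ ℙ.real (wrongStop P f S k) +
        ℙ.real (criticalCall P f S k ∩ {ω | o k ω = none}) :=
      (measureReal_mono (wrongStop_succ_subset hrun k)).trans (measureReal_union_le _ _)
    have h2 := hfail k (criticalCall P f S k) (measurableSet_criticalCall hU hS hSU k)
      fun ω hω => hω
    -- A critical call needs a running state, so it is disjoint from an earlier wrong termination;
    -- this gives the power of 1 - δ instead of a union bound kδ.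
    have h3 : ℙ.real (criticalCall P f S k) ≤ 1 - ℙ.real (wrongStop P f S k) := by
      rw [← probReal_compl_eq_one_sub hW]
      refine measureReal_mono ?_
      rintro ω ⟨hω, -⟩ ⟨hω', -⟩
      rw [hω] at hω'
      cases hω'
    have h4 := mul_le_mul_of_nonneg_left h3 hδ0
    rw [pow_succ]
    nlinarith

end Probability

/-! ### Order of magnitude of the iteration bound -/

section Order

/-- The dimension enters ω₂ only through a factor √n, so its logarithm contributes at most (log
n)/2. -/
lemma abs_log_omega2_bound {n : ℕ} (hn : 0 < n) {P : Params} {LH xmin xmax : ℝ} {x0 : Vec n}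
    (hmin : 0 < xmin) (hx : ∀ i, xmin ≤ x0 i ∧ x0 i ≤ xmax) :
    Real.log (omega2 P LH x0) - ⨅ i, Real.log (x0 i) ≤
      |Real.log (max (96 / (P.η * call LH P.θ P.ζr P.ζbar P.β P.η ^ 2)) xmax)| + |Real.log xmin| +
        Real.log n := by
  have : Nonempty (Fin n) := ⟨⟨0, hn⟩⟩
  have hn1 : (1 : ℝ) ≤ n := by exact_mod_cast hn
  have hs1 : 1 ≤ √(n : ℝ) := Real.one_le_sqrt.2 hn1
  set c := P.η * call LH P.θ P.ζr P.ζbar P.β P.η ^ 2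
  set a := max (96 / c) xmax with ha
  have hx0 := hx ⟨0, hn⟩
  have ha0 : 0 < a := lt_max_of_lt_right (by linarith)
  have h1 : Real.log xmin ≤ ⨅ i, Real.log (x0 i) :=
    le_ciInf fun i => Real.log_le_log hmin (hx i).1
  have h2 : omega2 P LH x0 ≤ a * √(n : ℝ) := by
    refine max_le ?_ ?_
    · calc 96 * √(n : ℝ) / c = 96 / c * √(n : ℝ) := by ring
        _ ≤ a * √(n : ℝ) := by
          gcongr
          exact le_max_left _ _
    · refine (supNorm_le_iff (by positivity) _).2 fun i => ?_
      have h3 := hx i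
      rw [abs_of_nonneg (by linarith)]
      calc x0 i ≤ a := h3.2.trans (le_max_right _ _)
        _ ≤ a * √(n : ℝ) := le_mul_of_one_le_right ha0.le hs1
  have h3 : 0 < omega2 P LH x0 := by
    have h4 := (le_abs_self _).trans (abs_le_supNorm x0 ⟨0, hn⟩)
    exact lt_max_of_lt_right (by linarith)
  have h4 := Real.log_le_log h3 h2
  rw [Real.log_mul ha0.ne' (by positivity), Real.log_sqrt (by positivity)] at h4
  have h5 := Real.log_nonneg hn1
  have h6 := le_abs_self (Real.log a)
  have h7 := neg_abs_le (Real.log xmin)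
  linarith

theorem K2_order (θ ζr ζbar β η LH Δmax xmin xmax : ℝ) (hL : 0 < LH)
    (hmin : 0 < xmin) :
    ∃ C : ℝ, ∀ (n : ℕ) (P : Params) (x0 : Vec n) (Δ : ℝ),
      0 < n → P.Valid → P.θ = θ → P.ζr = ζr → P.ζbar = ζbar → P.β = β → P.η = η →
      (∀ i, xmin ≤ x0 i ∧ x0 i ≤ xmax) → 0 ≤ Δ → Δ ≤ Δmax →
      (K2 P LH x0 Δ : ℝ) ≤
        C * (1 + Real.log n) * (n * P.εg ^ (-(1 / 2) : ℝ) + P.εg ^ (-(3 / 2) : ℝ)) := by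
  set c := call LH θ ζr ζbar β η
  set W := |Real.log (max (96 / (η * c ^ 2)) xmax)| + |Real.log xmin| + 1 with hW
  set A := 1536 / (η * c ^ 3) with hA
  -- The 3 consists of the summand 2 in K₂ and 1 for rounding up.
  refine ⟨A * Δmax + A * W + 3, ?_⟩
  rintro n P x0 Δ hn hP rfl rfl rfl rfl rfl hx hΔ0 hΔ
  have hn1 : (1 : ℝ) ≤ n := by exact_mod_cast hn
  have hln := Real.log_nonneg hn1
  have hlog := abs_log_omega2_bound (P := P) (LH := LH) hn hmin hx
  set ℓ := Real.log (omega2 P LH x0) - ⨅ i, Real.log (x0 i)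
  have hW1 : 1 ≤ W := by
    have h1 := abs_nonneg (Real.log (max (96 / (P.η * c ^ 2)) xmax))
    have h2 := abs_nonneg (Real.log xmin)
    linarith
  have hℓ : ℓ ≤ W * (1 + Real.log n) := by
    change ℓ ≤ |Real.log (max (96 / (P.η * c ^ 2)) xmax)| + |Real.log xmin| + Real.log n at hlog
    nlinarith
  have hc : 0 < c := call_pos hL hP.η_pos hP.β_lt hP.θ_pos hP.ζr_pos hP.ζbar_lt
  have hη := hP.η_pos
  have hA0 : 0 ≤ A := by positivity
  have hε := hP.εg_pos
  set p := P.εg ^ (-(1 / 2) : ℝ) with hp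
  set q := P.εg ^ (-(3 / 2) : ℝ) with hq
  have hp0 : 0 < p := Real.rpow_pos_of_pos hε _
  have hq1 : 1 ≤ q := Real.one_le_rpow_of_pos_of_le_one_of_nonpos hε hP.εg_lt.le (by norm_num)
  -- The factor ε_g in μ improves the exponent of the n-dependent term from -3/2 to -1/2.
  have hpq : P.εg * q = p := by
    rw [hp, hq, ← Real.rpow_one_add' hε.le (by norm_num)]
    norm_num
  set X := (1 + Real.log n) * (n * p + q) with hX
  have hqX : q ≤ X := by
    have h1 : 0 ≤ n * p := by positivity
    rw [hX]; nlinarith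
  have hpX : n * (1 + Real.log n) * p ≤ X := by
    have h1 : 0 ≤ (1 + Real.log n) * q := by positivity
    rw [hX]; linarith
  set Z := A * Δmax * q + A * W * (n * (1 + Real.log n) * p) with hZdef
  have hΔmax : 0 ≤ Δmax := hΔ0.trans hΔ
  have hZ0 : 0 ≤ Z := by positivity
  have hZ : 1536 * (Δ + P.μ * n * ℓ) / (P.η * c ^ 3) * q ≤ Z := by
    have h1 : P.μ * n * ℓ * q ≤ W * (n * (1 + Real.log n) * p) := by
      have h2 : P.μ * n * ℓ * q = n * p / 4 * ℓ := by rw [← hpq, Params.μ]; ring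
      have h3 := mul_le_mul_of_nonneg_left hℓ (by positivity : 0 ≤ n * p / 4)
      have h4 : 0 ≤ W * (n * (1 + Real.log n) * p) := by positivity
      rw [h2]; linarith
    have h2 : Δ * q ≤ Δmax * q := mul_le_mul_of_nonneg_right hΔ (by linarith)
    have h3 := mul_le_mul_of_nonneg_left (add_le_add h2 h1) hA0
    calc 1536 * (Δ + P.μ * n * ℓ) / (P.η * c ^ 3) * q
        = A * (Δ * q + P.μ * n * ℓ * q) := by rw [hA]; ring
      _ ≤ Z := h3.trans (le_of_eq (by rw [hZdef]; ring))
  have hceil : (⌈1536 * (Δ + P.μ * n * ℓ) / (P.η * c ^ 3) * q⌉₊ : ℝ) ≤ Z + 1 :=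
    (Nat.cast_le.2 (Nat.ceil_mono hZ)).trans (Nat.ceil_lt_add_one hZ0).le
  have hK : (K2 P LH x0 Δ : ℝ) ≤ Z + 3 := by
    rw [K2]
    push_cast
    linarith
  have h1 := mul_le_mul_of_nonneg_left hqX (by positivity : 0 ≤ A * Δmax)
  have h2 := mul_le_mul_of_nonneg_left hpX (by positivity : 0 ≤ A * W)
  rw [mul_assoc, ← hX]
  linarith

end Order

end LBNCG

theorem theorem4p9 :
    -- the iteration bound
    (∀ (n : ℕ) (_ : 0 < n) (P : LBNCG.Params) (_ : P.Valid)
      (f : LBNCG.Vec n → ℝ) (flow LH δ : ℝ) (x0 : LBNCG.Vec n) (U : Set (LBNCG.Vec n))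
      (Ω : Type*) (m : MeasurableSpace Ω) (ℙ : MeasureTheory.Measure Ω)
      (_ : MeasureTheory.IsProbabilityMeasure ℙ) (ℱ : MeasureTheory.Filtration ℕ m)
      (S : ℕ → Ω → LBNCG.State n) (d : ℕ → Ω → LBNCG.Vec n)
      (o : ℕ → Ω → Option (LBNCG.Vec n)),
      0 < LH → 0 ≤ δ → δ < 1 → (∀ i, 0 < x0 i) →
      LBNCG.LipschitzHessianOn f U LH →
      (∀ x : LBNCG.Vec n, (∀ i, 0 < x i) → flow ≤ f x) →
      (∀ k, Measurable[ℱ k] (S k)) →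
      (∀ ω, LBNCG.IsRun P f x0 (S · ω) (d · ω) (o · ω)) →
      (∀ ω, LBNCG.ContainsPath P f U (S · ω) (d · ω) (o · ω)) →
      (∀ ω, LBNCG.OracleSound P f (S · ω) (o · ω)) →
      LBNCG.OracleFailureLe ℙ ℱ P f S o δ →
      -- every run terminates within the bound, at an approximate first-order point
      (∀ ω, (S (LBNCG.K2 P LH x0 (f x0 - flow)) ω).1 = .stopped ∧
        LBNCG.EpsFirstOrder f P.εg (S (LBNCG.K2 P LH x0 (f x0 - flow)) ω).2) ∧
      -- it terminates correctly with high probability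
      (1 - δ) ^ LBNCG.K2 P LH x0 (f x0 - flow) ≤
        ℙ.real {ω | (S (LBNCG.K2 P LH x0 (f x0 - flow)) ω).1 = .stopped ∧
          LBNCG.EpsKKT f P.εg P.εH (S (LBNCG.K2 P LH x0 (f x0 - flow)) ω).2} ∧
      -- it terminates incorrectly with small probability
      ℙ.real {ω | (S (LBNCG.K2 P LH x0 (f x0 - flow)) ω).1 = .stopped ∧
          LBNCG.EpsFirstOrder f P.εg (S (LBNCG.K2 P LH x0 (f x0 - flow)) ω).2 ∧
          ¬ LBNCG.EpsSecondOrder f P.εH (S (LBNCG.K2 P LH x0 (f x0 - flow)) ω).2} ≤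
        1 - (1 - δ) ^ LBNCG.K2 P LH x0 (f x0 - flow)) ∧
    -- the order of the bound, up to a logarithmic factor
    (∀ (θ ζr ζbar β η LH Δmax xmin xmax : ℝ), 0 < LH → 0 < xmin →
      ∃ C : ℝ, ∀ (n : ℕ) (P : LBNCG.Params) (x0 : LBNCG.Vec n) (Δ : ℝ),
        0 < n → P.Valid → P.θ = θ → P.ζr = ζr → P.ζbar = ζbar → P.β = β → P.η = η →
        (∀ i, xmin ≤ x0 i ∧ x0 i ≤ xmax) → 0 ≤ Δ → Δ ≤ Δmax →
        (LBNCG.K2 P LH x0 Δ : ℝ) ≤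
          C * (1 + Real.log n) * (n * P.εg ^ (-(1 / 2) : ℝ) + P.εg ^ (-(3 / 2) : ℝ))) := by
  refine ⟨?_, fun θ ζr ζbar β η LH Δmax xmin xmax hL hmin =>
    LBNCG.K2_order θ ζr ζbar β η LH Δmax xmin xmax hL hmin⟩
  intro n hn P hP f flow LH δ x0 U Ω m ℙ hℙ ℱ S d o hL hδ0 hδ1 hx0 hU hflow hS hrun hpath hsound
    hfail
  have hSU : ∀ k ω, (S k ω).2 ∈ U := fun k ω => (hpath ω k).1
  have hterm := fun ω => LBNCG.run_terminates hn hP hU hL hflow hx0 (hrun ω) (hpath ω) (hsound ω)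
  set K := LBNCG.K2 P LH x0 (f x0 - flow)
  have hwrong := LBNCG.measureReal_wrongStop_le hU hδ0 hδ1 hS hrun hSU hfail K
  have hmeas : MeasurableSet (LBNCG.wrongStop P f S K) :=
    ℱ.le K _ (LBNCG.measurableSet_wrongStop hU hS hSU K)
  refine ⟨hterm, ?_, ?_⟩
  -- As every run has stopped at a first-order point, correct termination is exactly the complement
  -- of wrong termination.
  · have h : {ω | (S K ω).1 = .stopped ∧ LBNCG.EpsKKT f P.εg P.εH (S K ω).2} =
        (LBNCG.wrongStop P f S K)ᶜ := by
      ext ω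
      have h1 := hterm ω
      simp [LBNCG.wrongStop, LBNCG.EpsKKT, h1.1, h1.2]
    rw [h, MeasureTheory.probReal_compl_eq_one_sub hmeas]
    linarith
  · have h : {ω | (S K ω).1 = .stopped ∧ LBNCG.EpsFirstOrder f P.εg (S K ω).2 ∧
        ¬ LBNCG.EpsSecondOrder f P.εH (S K ω).2} = LBNCG.wrongStop P f S K := by
      ext ω
      have h1 := hterm ω
      simp [LBNCG.wrongStop, h1.1, h1.2]
    rw [h]
    exact hwrong
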